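/- Let $k$ be an algebraically closed field of characteristic $0$, let $X$ be a smooth projective three-fold over $k$, and let $R$ be a discrete valuation ring that is a $k$-algebra, with uniformiser $\pi$. Put $X_R = X\otimes_k R$ and, for $m\ge 1$, $X_m = X\otimes_k R/\pi^m$; the scheme $X_k := X_1$ is the central fibre of $X_R$. Let $\iota_m : X_m \hookrightarrow X_R$ and $\iota_{m,1} : X_1\hookrightarrow X_m$ denote the closed immersions. For a Noetherian scheme $Y$, let $D(Y)$ and $D^b(Y)$ be the unbounded and the bounded derived category of coherent sheaves on $Y$, realised as the full subcategories of the derived category of $\mathcal{O}_Y$-modules given by the complexes with coherent cohomology sheaves, respectively with coherent cohomology sheaves of which only finitely many are nonzero. Let $H^i$ be the standard cohomology sheaves. Let $\mathrm{Coh}_{\le 1}(Y)$ be the category of coherent sheaves with support of dimension at most $1$, let $\mathrm{Coh}_{\ge 2}(Y)$ be the category of coherent sheaves $M$ with $\mathrm{Hom}(F,M)=0$ for all $F\in \mathrm{Coh}_{\le 1}(Y)$, and put $$\mathcal{A}^p(Y)=\{E\in D^b(Y) : H^0(E)\in \mathrm{Coh}_{\le 1}(Y),\ H^{-1}(E)\in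 \mathrm{Coh}_{\ge 2}(Y),\ H^i(E)=0 \text{ for } i\ne 0,-1\},\qquad \mathcal{A}^p_m := \mathcal{A}^p(X_m).$$ Proposition. Let $m \ge 1$. (1) If $E\in D(X_m)$ satisfies $H^i(E)=0$ for all $i>0$ and $L\iota_{m,1}^*E\in \mathcal{A}^p(X_k)$, then $E\in\mathcal{A}^p_m$. (2) If $I\in D^b(X_R)$ is a flat family of objects in $\mathcal{A}^p$ over $\mathrm{Spec}\, R$, that is, if the derived restriction $L\iota_1^* I$ to the fibre over the closed point lies in $\mathcal{A}^p(X_k)$, then $L\iota_m^* I\in\mathcal{A}^p_m$. Here the derived pullback $Lf^*$ of an object with bounded above cohomology is computed by applying $f^*$ termwise to a bounded above complex of flat sheaves of modules that represents the object. -/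

import Mathlib

open CategoryTheory CategoryTheory.Limits AlgebraicGeometry

universe u

namespace PervHeart

noncomputable section

/-! ### Coherent sheaves, their dimension, and flat sheaves -/

/-- A sheaf of `𝒪_Y`-modules is coherent. All schemes below are Noetherian, where the coherent
sheaves are the sheaves of modules of finite presentation. -/
def IsCoherent {Y : Scheme.{u}} (M : Y.Modules) : Prop :=
  SheafOfModules.IsFinitePresentation.{u} (R := Y.ringCatSheaf) M

/-- The support of a sheaf of modules: the points at which the stalk is nonzero. -/
def supp {Y : Scheme.{u}} (M : Y.Modules) : Set Y :=
  {y | Nontrivial (M.presheaf.stalk y)}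

/-- `Coh_{≤ d}(Y)`: the coherent sheaves whose support has (Krull) dimension at most `d`.
The zero sheaf, with empty support of dimension `⊥`, is included. -/
def CohLE {Y : Scheme.{u}} (d : ℕ) (M : Y.Modules) : Prop :=
  IsCoherent M ∧ topologicalKrullDim (supp M) ≤ (d : WithBot ℕ∞)

/-- `Coh_{≥ d + 1}(Y)`: the coherent sheaves `M` with `Hom(F, M) = 0` for all `F` in
`Coh_{≤ d}(Y)`. -/
def CohGT {Y : Scheme.{u}} (d : ℕ) (M : Y.Modules) : Prop :=
  IsCoherent M ∧ ∀ F : Y.Modules, CohLE d F → ∀ f : F ⟶ M, f = 0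

/-- A presheaf of modules over a presheaf of commutative rings has flat stalks. -/
def HasFlatStalks {T : TopCat.{u}} {𝒪 : T.Presheaf CommRingCat.{u}}
    (M : PresheafOfModules.{u} (𝒪 ⋙ forget₂ CommRingCat RingCat)) : Prop :=
  ∀ x : T, Module.Flat (𝒪.stalk x) (TopCat.Presheaf.stalk (C := Ab.{u}) M.presheaf x)

/-- A sheaf of `𝒪_Y`-modules is flat: each stalk is a flat module over the local ring. -/
def IsFlat {Y : Scheme.{u}} (M : Y.Modules) : Prop :=
  HasFlatStalks (𝒪 := Y.presheaf) M.val

/-! ### Derived categories -/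

instance (Y : Scheme.{u}) : HasDerivedCategory.{u + 1} Y.Modules :=
  HasDerivedCategory.standard _

/-- The unbounded derived category of sheaves of `𝒪_Y`-modules. -/
abbrev DMod (Y : Scheme.{u}) := DerivedCategory Y.Modules

/-- The `i`-th cohomology sheaf, for the standard t-structure. -/
abbrev H {Y : Scheme.{u}} (i : ℤ) (E : DMod Y) : Y.Modules :=
  (DerivedCategory.homologyFunctor Y.Modules i).obj E

/-- Membership in `D(Y)`: the cohomology sheaves are coherent. -/
def MemD {Y : Scheme.{u}} (E : DMod Y) : Prop :=
  ∀ i : ℤ, IsCoherent (H i E)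

/-- Membership in `D^b(Y)`: moreover only finitely many cohomology sheaves are nonzero. -/
def MemDb {Y : Scheme.{u}} (E : DMod Y) : Prop :=
  MemD E ∧ ∃ a b : ℤ, ∀ i : ℤ, i < a ∨ b < i → IsZero (H i E)

/-- Membership in the heart `𝒜^p(Y) = ⟨Coh_{≤ 1}(Y), Coh_{≥ 2}(Y)[1]⟩`. -/
def MemHeart {Y : Scheme.{u}} (E : DMod Y) : Prop :=
  MemDb E ∧ CohLE 1 (H 0 E) ∧ CohGT 1 (H (-1) E) ∧
    ∀ i : ℤ, i ≠ 0 → i ≠ -1 → IsZero (H i E)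

/-- `P` is a bounded above complex of flat `𝒪_Z`-modules that represents `E`. -/
structure IsFlatResolution {Z : Scheme.{u}} (P : CochainComplex Z.Modules ℤ) (E : DMod Z) :
    Prop where
  bounded_above : ∃ n : ℤ, ∀ i : ℤ, n < i → IsZero (P.X i)
  flat : ∀ i : ℤ, IsFlat (P.X i)
  represents : Nonempty (DerivedCategory.Q.obj P ≅ E)

/-- `G` is (isomorphic to) the derived pullback `Lf^* E` of the bounded above object `E`:
it is obtained by applying `f^*` termwise to a bounded above flat resolution of `E`. -/
def IsDerivedPullback {Y Z : Scheme.{u}} (f : Y ⟶ Z) (E : DMod Z) (G : DMod Y) : Prop :=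
  ∃ P : CochainComplex Z.Modules ℤ, IsFlatResolution P E ∧
    Nonempty (DerivedCategory.Q.obj
      (((Scheme.Modules.pullback f).mapHomologicalComplex (ComplexShape.up ℤ)).obj P) ≅ G)

/-! ### Smooth projective threefolds and their base changes -/

attribute [local instance] MvPolynomial.gradedAlgebra in
/-- Projective space `ℙⁿ` over the field `k`. -/
def projSpace (k : Type u) [Field k] (n : ℕ) : Scheme.{u} :=
  Proj (MvPolynomial.homogeneousSubmodule (Fin (n + 1)) k)

attribute [local instance] MvPolynomial.gradedAlgebra in
/-- The structure morphism `ℙⁿ ⟶ Spec k`. -/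
def projSpaceStr (k : Type u) [Field k] (n : ℕ) : projSpace k n ⟶ Spec (.of k) :=
  Proj.toSpecZero (MvPolynomial.homogeneousSubmodule (Fin (n + 1)) k) ≫
    Spec.map (CommRingCat.ofHom
      (algebraMap k (MvPolynomial.homogeneousSubmodule (Fin (n + 1)) k 0)))

/-- The `k`-scheme `s : X ⟶ Spec k` is a smooth projective threefold: an integral scheme of
dimension three, smooth over `k`, and a closed subscheme of some `ℙⁿ` over `k`. -/
structure IsSmoothProjectiveThreefold {k : Type u} [Field k] {X : Scheme.{u}}
    (s : X ⟶ Spec (.of k)) : Prop where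
  integral : IsIntegral X
  smooth : Smooth s
  projective : ∃ (n : ℕ) (i : X ⟶ projSpace k n), IsClosedImmersion i ∧ i ≫ projSpaceStr k n = s
  dim_eq : topologicalKrullDim X = 3

section BaseChange

variable {k : Type u} [Field k] {X : Scheme.{u}} (s : X ⟶ Spec (.of k))

/-- `X ⊗_k A` for a `k`-algebra `A`. -/
def baseChange (A : Type u) [CommRing A] [Algebra k A] : Scheme.{u} :=
  pullback s (Spec.map (CommRingCat.ofHom (algebraMap k A)))

/-- The morphism `X ⊗_k B ⟶ X ⊗_k A` induced by a homomorphism of `k`-algebras `A → B`. -/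
def baseChangeMap {A B : Type u} [CommRing A] [Algebra k A] [CommRing B] [Algebra k B]
    (φ : A →ₐ[k] B) : baseChange s B ⟶ baseChange s A :=
  pullback.map s (Spec.map (CommRingCat.ofHom (algebraMap k B))) s
    (Spec.map (CommRingCat.ofHom (algebraMap k A)))
    (𝟙 X) (Spec.map (CommRingCat.ofHom φ.toRingHom)) (𝟙 _) (by simp)
    (by
      rw [Category.comp_id, ← Spec.map_comp, ← CommRingCat.ofHom_comp]
      congr 2
      exact φ.comp_algebraMap.symm)

variable {R : Type u} [CommRing R] [Algebra k R] (π : R)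

/-- `X_m = X ⊗_k R/π^m`. In particular `X_1` is the central fibre `X_k` of `X_R = X ⊗_k R`. -/
abbrev thickening (m : ℕ) : Scheme.{u} :=
  baseChange s (R ⧸ Ideal.span {π ^ m})

/-- The closed immersion `ι_m : X_m ⟶ X_R`. -/
def iota (m : ℕ) : thickening s π m ⟶ baseChange s R :=
  baseChangeMap s (Ideal.Quotient.mkₐ k (Ideal.span {π ^ m}))

/-- The closed immersion `ι_{m,m'} : X_{m'} ⟶ X_m`, for `m' ≤ m`. -/
def iotaTrans {m m' : ℕ} (h : m' ≤ m) : thickening s π m' ⟶ thickening s π m :=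
  baseChangeMap s (Ideal.Quotient.factorₐ k
    (Ideal.span_singleton_le_span_singleton.mpr (pow_dvd_pow π h)))

/-- `I ∈ D^b(X_R)` is a flat family of objects in `𝒜^p` over `Spec R`, where `R` is a discrete
valuation ring with uniformiser `π`: its derived restriction to the fibre over each closed point
of `Spec R` lies in `𝒜^p` of that fibre. The only closed point is the one defined by `π`, and the
fibre over it is `X_1 = X ⊗_k R/π`. -/
def IsFlatFamily (I : DMod (baseChange s R)) : Prop :=
  MemDb I ∧ ∃ G : DMod (thickening s π 1), IsDerivedPullback (iota s π 1) I G ∧ MemHeart G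

end BaseChange

end

end PervHeart

open PervHeart

namespace PervHeart

noncomputable section

/-! ### Stalks of sheaves of modules -/

section Stalks

open TopologicalSpace

variable {X : Scheme.{u}}

/-! The uniformiser exhibits an object over `X_m` as an iterated extension of copies of its
restriction to `X_1`. Represent `E` by a bounded above complex `P` of flat modules. Its terms are
flat over `R/π^m`, because `X_m` is. In `R/π^m` the annihilator of `π^j` is generated by `π^i` when
`i + j = m`; flatness carries this over to the terms of `P`. Hence `P` is filtered by the
subcomplexes `π^i P`, with `m` graded pieces isomorphic to `P/πP`, and `P/πP` is the pushforward of
`ι_{m,1}^* P` (`of_cokernel_of_exact_powers`, `IsCutOutBy.exact_unit`).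

The conditions of the heart other than coherence, collected in `HeartLike`, survive pushforward and
extension. The long exact sequence handles vanishing and supports. A map from `F` to the pushforward
of `H^{-1}` is a map from the pullback of `F`, which again lies in `Coh_{≤ 1}`. In an extension,
vanishing of `H^{-2}` makes the sequence of the `H^{-1}` left exact. This gives
`HeartLike.of_pullback`, hence (1), where coherence is given.

For (2), let `P` be a flat resolution of `I` on `X_R`. Then `ι_m^* P` represents `Lι_m^* I` and
restricts to `ι_1^* P` on `X_1`. Exactness of the powers of `π` on its terms `P^n/π^m P^n` follows
from injectivity of `π` on `P^n`, so the same filtration applies. Two points remain. Coherence of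
the cohomology of `ι_m^* P` comes from the long exact sequence of multiplication by `π^m`
(`isCoherent_homology_pullback`), using that coherent sheaves are closed under kernels, cokernels
and extensions. The family hypothesis may use another resolution than `P`; the two restrictions to
`X_1` are compared through the cone of multiplication by `π` (`homology_pullback_iso`).

Terms of flat resolutions need not be quasi-coherent, so pullback and pushforward are studied for
arbitrary sheaves of modules, by means of stalks. -/

lemma preservesColimitsOfShape_toSheaf (K : Type) [SmallCategory K] [FinCategory K] :
    PreservesColimitsOfShape K (SheafOfModules.toSheaf.{u} X.ringCatSheaf) := by
  let adj := PresheafOfModules.sheafificationAdjunction.{u} (𝟙 X.ringCatSheaf.obj)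
  have h1 : PreservesColimitsOfShape K
      (PresheafOfModules.sheafification.{u} (𝟙 X.ringCatSheaf.obj) ⋙
        SheafOfModules.toSheaf.{u} X.ringCatSheaf) :=
    preservesColimitsOfShape_of_natIso
      (F := PresheafOfModules.toPresheaf _ ⋙
        presheafToSheaf (Opens.grothendieckTopology X) AddCommGrpCat)
      (PresheafOfModules.sheafificationCompToSheaf.{u} (𝟙 X.ringCatSheaf.obj)).symm
  constructor
  intro F
  -- A diagram of sheaves of modules is the sheafification of its underlying diagram of presheaves,
  -- and sheafifying modules agrees on abelian groups with the ordinary sheafification, which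
  -- preserves colimits.
  let G := F ⋙ SheafOfModules.forget X.ringCatSheaf
  let e : F ≅ G ⋙ PresheafOfModules.sheafification (𝟙 X.ringCatSheaf.obj) :=
      Functor.isoWhiskerLeft F
        (asIso (PresheafOfModules.sheafificationAdjunction (𝟙 X.ringCatSheaf.obj)).counit).symm
  have : PreservesColimitsOfShape K
      (PresheafOfModules.sheafification.{u} (𝟙 X.ringCatSheaf.obj)) :=
    adj.leftAdjoint_preservesColimits.preservesColimitsOfShape
  have : PreservesColimit (G ⋙ PresheafOfModules.sheafification (𝟙 X.ringCatSheaf.obj))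
      (SheafOfModules.toSheaf.{u} X.ringCatSheaf) := by
    refine preservesColimit_of_preserves_colimit_cocone
      (isColimitOfPreserves (PresheafOfModules.sheafification (𝟙 X.ringCatSheaf.obj))
        (colimit.isColimit G)) ?_
    exact isColimitOfPreserves (PresheafOfModules.sheafification.{u} (𝟙 X.ringCatSheaf.obj) ⋙
        SheafOfModules.toSheaf.{u} X.ringCatSheaf) (colimit.isColimit G)
  exact preservesColimit_of_iso_diagram _ e.symm

variable (X) in
/-- The forgetful functor from sheaves of modules to sheaves of abelian groups. -/
def toAb : X.Modules ⥤ TopCat.Sheaf Ab.{u} X := SheafOfModules.toSheaf.{u} X.ringCatSheaf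

instance : PreservesFiniteColimits (toAb X) where
  preservesFiniteColimits K _ _ := preservesColimitsOfShape_toSheaf K

instance : PreservesFiniteLimits (toAb X) :=
  inferInstanceAs (PreservesFiniteLimits (SheafOfModules.toSheaf.{u} X.ringCatSheaf))

instance : (toAb X).Additive :=
  inferInstanceAs (SheafOfModules.toSheaf.{u} X.ringCatSheaf).Additive

instance : (toAb X).Faithful :=
  inferInstanceAs (SheafOfModules.toSheaf.{u} X.ringCatSheaf).Faithful

/-- The stalk at a point, as a functor to abelian groups. -/
def stalkAb (x : X) : X.Modules ⥤ Ab.{u} :=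
  toAb X ⋙ TopCat.Sheaf.forget Ab.{u} X ⋙ TopCat.Presheaf.stalkFunctor Ab.{u} x

instance (x : X) : (stalkAb x).Additive := by
  unfold stalkAb
  infer_instance

instance (x : X) : PreservesFiniteLimits (stalkAb x) :=
  comp_preservesFiniteLimits (toAb X)
    (TopCat.Sheaf.forget Ab.{u} X ⋙ TopCat.Presheaf.stalkFunctor Ab.{u} x)

instance (x : X) : PreservesFiniteColimits (stalkAb x) :=
  comp_preservesFiniteColimits (toAb X)
    (TopCat.Sheaf.forget Ab.{u} X ⋙ TopCat.Presheaf.stalkFunctor Ab.{u} x)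

lemma exact_toAb (S : ShortComplex X.Modules) : (S.map (toAb X)).Exact ↔ S.Exact :=
  S.exact_map_iff_of_faithful (toAb X)

lemma exact_iff_stalk (S : ShortComplex X.Modules) :
    S.Exact ↔ ∀ x : X, (S.map (stalkAb x)).Exact := by
  rw [← exact_toAb]
  exact TopCat.Sheaf.exact_iff_stalkFunctor_map_exact _

lemma mem_supp_iff (M : X.Modules) (x : X) : x ∈ supp M ↔ ¬ IsZero ((stalkAb x).obj M) := by
  rw [AddCommGrpCat.isZero_iff_subsingleton, not_subsingleton_iff_nontrivial]
  rfl

lemma mono_iff_stalk {M N : X.Modules} (f : M ⟶ N) :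
    Mono f ↔ ∀ x : X, Mono ((stalkAb x).map f) := by
  refine ⟨fun h x => inferInstance, fun h => ?_⟩
  rw [← (ShortComplex.mk (0 : M ⟶ M) f (by simp)).exact_iff_mono rfl, exact_iff_stalk]
  intro x
  have := h x
  exact ((ShortComplex.mk (0 : M ⟶ M) f (by simp)).map (stalkAb x)).exact_iff_mono
    ((stalkAb x).map_zero _ _) |>.2 (h x)

lemma epi_iff_stalk {M N : X.Modules} (f : M ⟶ N) :
    Epi f ↔ ∀ x : X, Epi ((stalkAb x).map f) := by
  refine ⟨fun h x => inferInstance, fun h => ?_⟩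
  rw [← (ShortComplex.mk f (0 : N ⟶ N) (by simp)).exact_iff_epi rfl, exact_iff_stalk]
  intro x
  exact ((ShortComplex.mk f (0 : N ⟶ N) (by simp)).map (stalkAb x)).exact_iff_epi
    ((stalkAb x).map_zero _ _) |>.2 (h x)

/-- The germ of a section. -/
def germ (M : X.Modules) (U : X.Opens) (x : X) (hx : x ∈ U) :
    Γ(M, U) ⟶ (stalkAb x).obj M := TopCat.Presheaf.germ M.presheaf U x hx

lemma germ_map {M N : X.Modules} (f : M ⟶ N) (U : X.Opens) (x : X) (hx : x ∈ U)
    (s : Γ(M, U)) : (stalkAb x).map f (germ M U x hx s) = germ N U x hx (f.app U s) :=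
  TopCat.Presheaf.stalkFunctor_map_germ_apply U x hx f.mapPresheaf s

lemma germ_res (M : X.Modules) {U V : X.Opens} (i : V ⟶ U) (x : X) (hx : x ∈ V)
    (s : Γ(M, U)) : germ M V x hx (M.presheaf.map i.op s) = germ M U x (i.le hx) s :=
  TopCat.Presheaf.germ_res_apply M.presheaf i x hx s

lemma exists_germ_eq (M : X.Modules) (x : X) (s : (stalkAb x).obj M) :
    ∃ (U : X.Opens) (hx : x ∈ U) (t : Γ(M, U)), germ M U x hx t = s :=
  TopCat.Presheaf.exists_germ_eq M.presheaf s

lemma germ_eq_iff (M : X.Modules) {U V : X.Opens} (x : X) (hU : x ∈ U) (hV : x ∈ V)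
    (s : Γ(M, U)) (t : Γ(M, V)) (h : germ M U x hU s = germ M V x hV t) :
    ∃ (W : X.Opens) (_ : x ∈ W) (iU : W ⟶ U) (iV : W ⟶ V),
      M.presheaf.map iU.op s = M.presheaf.map iV.op t :=
  TopCat.Presheaf.germ_eq M.presheaf x hU hV s t h

lemma section_ext_germ (M : X.Modules) (U : X.Opens) (s t : Γ(M, U))
    (h : ∀ (x : X) (hx : x ∈ U), germ M U x hx s = germ M U x hx t) : s = t :=
  TopCat.Presheaf.section_ext ⟨M.presheaf, M.isSheaf⟩ U s t h

instance (M : X.Modules) (x : X) : Module (X.presheaf.stalk x) ((stalkAb x).obj M) :=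
  PresheafOfModules.instModuleCarrierStalkCommRingCatCarrierAbPresheafOpensCarrier
    (R := X.presheaf) M.val x

lemma germ_smul' (M : X.Modules) (U : X.Opens) (x : X) (hx : x ∈ U) (r : Γ(X, U))
    (m : Γ(M, U)) : germ M U x hx (r • m) = X.presheaf.germ U x hx r • germ M U x hx m :=
  PresheafOfModules.germ_smul (R := X.presheaf) M.val x U hx r m

lemma hom_ext_germ {M N : X.Modules} (f g : M ⟶ N)
    (h : ∀ x : X, (stalkAb x).map f = (stalkAb x).map g) : f = g := by
  ext U s
  refine section_ext_germ _ _ _ _ fun x hx => ?_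
  rw [← germ_map, ← germ_map, h]

lemma exists_germ_eq_pair (M : X.Modules) (x : X) (r : X.presheaf.stalk x)
    (m : (stalkAb x).obj M) : ∃ (U : X.Opens) (hx : x ∈ U) (a : Γ(X, U)) (t : Γ(M, U)),
      X.presheaf.germ U x hx a = r ∧ germ M U x hx t = m := by
  obtain ⟨U, hU, m, rfl⟩ := exists_germ_eq M x m
  obtain ⟨V, hV, r, rfl⟩ := TopCat.Presheaf.exists_germ_eq X.presheaf r
  have hW : x ∈ U ⊓ V := ⟨hU, hV⟩
  exact ⟨U ⊓ V, hW, X.presheaf.map (homOfLE (inf_le_right : U ⊓ V ≤ V)).op r,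
    M.presheaf.map (homOfLE (inf_le_left : U ⊓ V ≤ U)).op m,
    TopCat.Presheaf.germ_res_apply X.presheaf _ x hW r, germ_res M _ x hW m⟩

/-- The map on stalks induced by a morphism of sheaves of modules is linear over the local ring. -/
lemma stalkAb_map_smul {M N : X.Modules} (f : M ⟶ N) (x : X) (r : X.presheaf.stalk x)
    (m : (stalkAb x).obj M) : (stalkAb x).map f (r • m) = r • (stalkAb x).map f m := by
  obtain ⟨U, hU, r, m, rfl, rfl⟩ := exists_germ_eq_pair M x r m
  rw [← germ_smul', germ_map, Scheme.Modules.Hom.app_smul, germ_smul', germ_map]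

end Stalks

/-! ### Multiplication by global functions -/

section Multiplication

variable {X : Scheme.{u}}

/-- Multiplication by a global function, as an endomorphism of a sheaf of modules. -/
def mulHom (a : Γ(X, ⊤)) (M : X.Modules) : M ⟶ M :=
  ⟨PresheafOfModules.homMk (M₁ := M.val) (M₂ := M.val)
    { app U := M.smul (X.presheaf.map (homOfLE le_top : U.unop ⟶ ⊤).op a)
      naturality U V i := by
        have h : X.presheaf.map (homOfLE le_top : V.unop ⟶ ⊤).op =
          X.presheaf.map (homOfLE le_top : U.unop ⟶ ⊤).op ≫ X.presheaf.map i := by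
          rw [← Functor.map_comp]; rfl
        rw [h]
        exact (Scheme.Modules.map_comp_smul (M := M) i.unop _).symm }
    (fun U r m => smul_comm (X.presheaf.map (homOfLE le_top : U.unop ⟶ ⊤).op a)
      (show Γ(X, U.unop) from r) (show Γ(M, U.unop) from m))⟩

lemma mulHom_app_apply (a : Γ(X, ⊤)) (M : X.Modules) (U : X.Opens) (m : Γ(M, U)) :
    (mulHom a M).app U m = X.presheaf.map (homOfLE le_top : U ⟶ ⊤).op a • m := rfl

lemma mulHom_naturality (a : Γ(X, ⊤)) {M N : X.Modules} (f : M ⟶ N) :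
    mulHom a M ≫ f = f ≫ mulHom a N := by
  ext U m
  simp [mulHom_app_apply]

lemma mulHom_mul (a b : Γ(X, ⊤)) (M : X.Modules) :
    mulHom (a * b) M = mulHom a M ≫ mulHom b M := by
  ext U m
  change _ = (mulHom b M).app U ((mulHom a M).app U m)
  rw [mulHom_app_apply, mulHom_app_apply, mulHom_app_apply, map_mul, mul_comm, mul_smul]

lemma mulHom_zero (M : X.Modules) : mulHom (0 : Γ(X, ⊤)) M = 0 := by
  ext U m
  simp [mulHom_app_apply]

lemma mulHom_stalk (a : Γ(X, ⊤)) (M : X.Modules) (x : X) (m : (stalkAb x).obj M) :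
    (stalkAb x).map (mulHom a M) m = X.presheaf.germ ⊤ x trivial a • m := by
  obtain ⟨U, hU, m, rfl⟩ := exists_germ_eq M x m
  rw [germ_map, mulHom_app_apply, germ_smul', TopCat.Presheaf.germ_res_apply]

variable {Y : Scheme.{u}} (f : X ⟶ Y)

lemma pushforward_map_mulHom (a : Γ(Y, ⊤)) (M : X.Modules) :
    (Scheme.Modules.pushforward f).map (mulHom (f.appTop a) M) =
      mulHom a ((Scheme.Modules.pushforward f).obj M) := by
  ext U m
  have h : X.presheaf.map (homOfLE le_top : f ⁻¹ᵁ U ⟶ ⊤).op (f.appTop a) =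
      f.app U (Y.presheaf.map (homOfLE le_top : U ⟶ ⊤).op a) := by
    have := f.naturality (homOfLE le_top : U ⟶ ⊤).op
    exact (ConcreteCategory.congr_hom this a).symm
  exact (mulHom_app_apply (f.appTop a) M (f ⁻¹ᵁ U) m).trans
    (congrArg (fun r => r • (show Γ(M, f ⁻¹ᵁ U) from m)) h)

/-- Sections of a pullback are not directly accessible. Transposing both sides through the
adjunction leaves the fact that the unit commutes with multiplication by `a`. -/
lemma pullback_map_mulHom (a : Γ(Y, ⊤)) (M : Y.Modules) :
    (Scheme.Modules.pullback f).map (mulHom a M) =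
      mulHom (f.appTop a) ((Scheme.Modules.pullback f).obj M) := by
  apply ((Scheme.Modules.pullbackPushforwardAdjunction f).homEquiv _ _).injective
  rw [Adjunction.homEquiv_unit, Adjunction.homEquiv_unit, pushforward_map_mulHom]
  exact ((Scheme.Modules.pullbackPushforwardAdjunction f).unit_naturality _).trans
    (mulHom_naturality a ((Scheme.Modules.pullbackPushforwardAdjunction f).unit.app M))

end Multiplication

/-! ### Pushforward along closed immersions -/

section Pushforward

variable {Z X : Scheme.{u}} (f : Z ⟶ X)

/-- The comparison map from the stalk of a pushforward. -/
def pushforwardStalk (M : Z.Modules) (z : Z) :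
    (stalkAb (f z)).obj ((Scheme.Modules.pushforward f).obj M) ⟶ (stalkAb z).obj M :=
  TopCat.Presheaf.stalkPushforward Ab.{u} f.base M.presheaf z

lemma pushforwardStalk_germ (M : Z.Modules) (z : Z) (U : X.Opens) (hz : f z ∈ U)
    (s : Γ(M, f ⁻¹ᵁ U)) :
    pushforwardStalk f M z (germ ((Scheme.Modules.pushforward f).obj M) U (f z) hz s) =
      germ M (f ⁻¹ᵁ U) z hz s :=
  ConcreteCategory.congr_hom
    (TopCat.Presheaf.stalkPushforward_germ Ab.{u} f.base M.presheaf U z hz) s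

lemma pushforwardStalk_naturality {M N : Z.Modules} (g : M ⟶ N) (z : Z) :
    (stalkAb (f z)).map ((Scheme.Modules.pushforward f).map g) ≫ pushforwardStalk f N z =
      pushforwardStalk f M z ≫ (stalkAb z).map g := by
  ext m
  obtain ⟨U, hU, m, rfl⟩ := exists_germ_eq _ _ m
  change pushforwardStalk f N z ((stalkAb (f z)).map _ _) =
    (stalkAb z).map g (pushforwardStalk f M z _)
  rw [germ_map]
  refine (pushforwardStalk_germ f N z U hU _).trans ?_
  refine Eq.trans ?_ (congrArg _ (pushforwardStalk_germ f M z U hU m).symm)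
  exact (germ_map g (f ⁻¹ᵁ U) z hU m).symm

variable [IsClosedImmersion f]

instance (M : Z.Modules) (z : Z) : IsIso (pushforwardStalk f M z) :=
  TopCat.Presheaf.stalkPushforward.stalkPushforward_iso_of_isInducing Ab.{u}
    (f := f.base) f.isClosedEmbedding.isInducing M.presheaf z

lemma isZero_stalk_pushforward (M : Z.Modules) (x : X) (hx : x ∉ Set.range f) :
    IsZero ((stalkAb x).obj ((Scheme.Modules.pushforward f).obj M)) := by
  rw [AddCommGrpCat.isZero_iff_subsingleton]
  refine subsingleton_of_forall_eq 0 fun m => ?_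
  obtain ⟨U, hU, m, rfl⟩ := exists_germ_eq _ _ m
  let V : X.Opens := ⟨(Set.range f)ᶜ, f.isClosedEmbedding.isClosed_range.isOpen_compl⟩
  have hW : x ∈ U ⊓ V := ⟨hU, hx⟩
  have h0 : f ⁻¹ᵁ (U ⊓ V) = ⊥ := by
    ext z
    simp [V]
  have : Subsingleton Γ(M, f ⁻¹ᵁ (U ⊓ V)) := by
    rw [h0]
    exact AddCommGrpCat.subsingleton_of_isZero
      ((TopCat.Sheaf.isTerminalOfEmpty ⟨M.presheaf, M.isSheaf⟩).isZero)
  rw [← germ_res _ (homOfLE (inf_le_left : U ⊓ V ≤ U)) x hW]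
  have h : ((Scheme.Modules.pushforward f).obj M).presheaf.map
      (homOfLE (inf_le_left : U ⊓ V ≤ U)).op m = 0 := this.elim _ _
  rw [h, map_zero]

lemma epi_pushforward_map {M N : Z.Modules} (g : M ⟶ N) [Epi g] :
    Epi ((Scheme.Modules.pushforward f).map g) := by
  rw [epi_iff_stalk]
  intro x
  by_cases hx : x ∈ Set.range f
  · obtain ⟨z, rfl⟩ := hx
    have h := pushforwardStalk_naturality f g z
    have : (stalkAb (f z)).map ((Scheme.Modules.pushforward f).map g) =
        pushforwardStalk f M z ≫ (stalkAb z).map g ≫ inv (pushforwardStalk f N z) := by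
      rw [← reassoc_of% h, IsIso.hom_inv_id, Category.comp_id]
    rw [this]
    infer_instance
  · exact IsZero.epi (isZero_stalk_pushforward f N x hx) _

instance : PreservesFiniteLimits (Scheme.Modules.pushforward f) :=
  have : PreservesLimits (Scheme.Modules.pushforward f) :=
    (Scheme.Modules.pullbackPushforwardAdjunction f).rightAdjoint_preservesLimits
  inferInstance

instance : PreservesFiniteColimits (Scheme.Modules.pushforward f) := by
  have h0 : ∀ S : ShortComplex Z.Modules, S.ShortExact →
      (S.map (Scheme.Modules.pushforward f)).ShortExact := by
    have h1 := ((Scheme.Modules.pushforward f).preservesFiniteLimits_tfae.out 3 0).1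
      (inferInstance : PreservesFiniteLimits (Scheme.Modules.pushforward f))
    intro S hS
    have := hS.epi_g
    have h2 := h1 S hS
    exact ShortComplex.ShortExact.mk' h2.1 h2.2 (epi_pushforward_map f S.g)
  have h3 : PreservesFiniteLimits (Scheme.Modules.pushforward f) ∧
      PreservesFiniteColimits (Scheme.Modules.pushforward f) :=
    ((Scheme.Modules.pushforward f).exact_tfae.out 0 3).1 h0
  exact h3.2

instance : (Scheme.Modules.pushforward f).Faithful where
  map_injective {M N} g h e := by
    refine hom_ext_germ _ _ fun z => ?_
    rw [← cancel_epi (pushforwardStalk f M z), ← pushforwardStalk_naturality,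
      ← pushforwardStalk_naturality, e]

lemma supp_pushforward (M : Z.Modules) :
    supp ((Scheme.Modules.pushforward f).obj M) = f '' supp M := by
  ext x
  rw [mem_supp_iff]
  by_cases hx : x ∈ Set.range f
  · obtain ⟨z, rfl⟩ := hx
    rw [f.isClosedEmbedding.injective.mem_set_image, mem_supp_iff,
      (asIso (pushforwardStalk f M z)).isZero_iff]
  · simp only [isZero_stalk_pushforward f M x hx, not_true_eq_false, Set.mem_image, false_iff]
    rintro ⟨z, -, rfl⟩
    exact hx ⟨z, rfl⟩

end Pushforward

section PushforwardFull

variable {Z X : Scheme.{u}} (f : Z ⟶ X)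

lemma pushforwardStalk_smul (M : Z.Modules) (z : Z) (r : X.presheaf.stalk (f z))
    (m : (stalkAb (f z)).obj ((Scheme.Modules.pushforward f).obj M)) :
    pushforwardStalk f M z (r • m) = f.stalkMap z r • pushforwardStalk f M z m := by
  obtain ⟨U, hU, r, m, rfl, rfl⟩ := exists_germ_eq_pair _ _ r m
  rw [← germ_smul']
  refine (pushforwardStalk_germ f M z U hU _).trans ?_
  refine (germ_smul' M (f ⁻¹ᵁ U) z hU (f.app U r) m).trans ?_
  rw [Scheme.Hom.germ_stalkMap_apply]
  exact congrArg _ (pushforwardStalk_germ f M z U hU m).symm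

variable [IsClosedImmersion f]

/-- The largest open subset whose preimage along a closed immersion is a given open subset. -/
def openExtend (V : Z.Opens) : X.Opens :=
  ⟨(f '' (V : Set Z)ᶜ)ᶜ, (f.isClosedEmbedding.isClosedMap _ V.2.isClosed_compl).isOpen_compl⟩

lemma preimage_openExtend (V : Z.Opens) : f ⁻¹ᵁ (openExtend f V) = V := by
  ext z
  change f z ∈ (f '' (V : Set Z)ᶜ)ᶜ ↔ z ∈ V
  rw [Set.mem_compl_iff, f.isClosedEmbedding.injective.mem_set_image]
  simp

lemma openExtend_mono {V W : Z.Opens} (h : V ≤ W) : openExtend f V ≤ openExtend f W := by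
  refine Set.compl_subset_compl.2 (Set.image_mono ?_)
  exact Set.compl_subset_compl.2 h

variable {M N : Z.Modules}
  (g : (Scheme.Modules.pushforward f).obj M ⟶ (Scheme.Modules.pushforward f).obj N)

/-- The components of a preimage of a morphism between pushforwards. -/
def pushforwardPreimageApp (V : Z.Opens) : Γ(M, V) ⟶ Γ(N, V) :=
  M.presheaf.map (eqToHom (preimage_openExtend f V)).op ≫
    (show Γ(M, f ⁻¹ᵁ openExtend f V) ⟶ Γ(N, f ⁻¹ᵁ openExtend f V) from g.app (openExtend f V)) ≫
    N.presheaf.map (eqToHom (preimage_openExtend f V).symm).op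

lemma pushforwardPreimageApp_naturality {V W : Z.Opens} (i : V ⟶ W) :
    M.presheaf.map i.op ≫ pushforwardPreimageApp f g V =
      pushforwardPreimageApp f g W ≫ N.presheaf.map i.op := by
  have h := g.mapPresheaf.naturality (homOfLE (openExtend_mono f i.le)).op
  unfold pushforwardPreimageApp
  let k := homOfLE (f.preimage_mono (openExtend_mono f i.le))
  let gV : Γ(M, f ⁻¹ᵁ openExtend f V) ⟶ Γ(N, f ⁻¹ᵁ openExtend f V) := g.app (openExtend f V)
  let gW : Γ(M, f ⁻¹ᵁ openExtend f W) ⟶ Γ(N, f ⁻¹ᵁ openExtend f W) := g.app (openExtend f W)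
  change M.presheaf.map k.op ≫ gV = gW ≫ N.presheaf.map k.op at h
  change _ ≫ _ ≫ gV ≫ _ = (_ ≫ gW ≫ _) ≫ _
  have hM : M.presheaf.map i.op ≫ M.presheaf.map (eqToHom (preimage_openExtend f V)).op =
      M.presheaf.map (eqToHom (preimage_openExtend f W)).op ≫ M.presheaf.map k.op := by
    rw [← Functor.map_comp, ← Functor.map_comp]; rfl
  have hN : N.presheaf.map (eqToHom (preimage_openExtend f W).symm).op ≫ N.presheaf.map i.op =
      N.presheaf.map k.op ≫ N.presheaf.map (eqToHom (preimage_openExtend f V).symm).op := by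
    rw [← Functor.map_comp, ← Functor.map_comp]; rfl
  simp only [Category.assoc]
  rw [hN, reassoc_of% hM, reassoc_of% h]

/-- The map on stalks induced by a morphism between pushforwards. -/
def pushforwardTransport (z : Z) : (stalkAb z).obj M ⟶ (stalkAb z).obj N :=
  inv (pushforwardStalk f M z) ≫ (stalkAb (f z)).map g ≫ pushforwardStalk f N z

lemma pushforwardTransport_apply (z : Z)
    (m : (stalkAb (f z)).obj ((Scheme.Modules.pushforward f).obj M)) :
    pushforwardTransport f g z (pushforwardStalk f M z m) =
      pushforwardStalk f N z ((stalkAb (f z)).map g m) := by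
  simp only [pushforwardTransport, ← ConcreteCategory.comp_apply, IsIso.hom_inv_id_assoc]

lemma germ_pushforwardPreimageApp (V : Z.Opens) (z : Z) (hz : z ∈ V) (m : Γ(M, V)) :
    germ N V z hz (pushforwardPreimageApp f g V m) =
      pushforwardTransport f g z
        (germ M V z hz m) := by
  have hz' : z ∈ f ⁻¹ᵁ (openExtend f V) := by rwa [preimage_openExtend]
  let m' : Γ(M, f ⁻¹ᵁ (openExtend f V)) :=
    M.presheaf.map (eqToHom (preimage_openExtend f V)).op m
  have h1 : germ M V z hz m = pushforwardStalk f M z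
      (germ ((Scheme.Modules.pushforward f).obj M) (openExtend f V) (f z) hz' m') := by
    refine Eq.trans ?_ (pushforwardStalk_germ f M z (openExtend f V) hz' m').symm
    exact (germ_res M (eqToHom (preimage_openExtend f V)) z hz' m).symm
  rw [h1, pushforwardTransport_apply]
  refine Eq.trans ?_ (congrArg _ (germ_map g (openExtend f V) (f z) hz' m').symm)
  refine Eq.trans ?_ (pushforwardStalk_germ f N z (openExtend f V) hz' _).symm
  exact germ_res N (eqToHom (preimage_openExtend f V).symm) z hz _

lemma pushforwardPreimage_stalk_smul (z : Z) (r : Z.presheaf.stalk z) (m : (stalkAb z).obj M) :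
    pushforwardTransport f g z (r • m) =
      r • pushforwardTransport f g z m := by
  obtain ⟨r, rfl⟩ := f.stalkMap_surjective z r
  obtain ⟨m, rfl⟩ : ∃ m', pushforwardStalk f M z m' = m :=
    ⟨inv (pushforwardStalk f M z) m, by rw [← ConcreteCategory.comp_apply]; simp⟩
  rw [← pushforwardStalk_smul, pushforwardTransport_apply, pushforwardTransport_apply,
    stalkAb_map_smul, pushforwardStalk_smul]

/-- Every open of `Z` is a preimage, so a morphism of pushforwards supplies maps on all sections of
`M`. They are linear over the structure sheaf of `Z` because the maps of local rings are surjective.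
Off the image of `f` the stalks vanish and there is nothing to compare. -/
instance : (Scheme.Modules.pushforward f).Full where
  map_surjective {M N} g := by
    refine ⟨⟨PresheafOfModules.homMk (M₁ := M.val) (M₂ := N.val)
      { app U := pushforwardPreimageApp f g U.unop
        naturality U V i := pushforwardPreimageApp_naturality f g i.unop }
      (fun U r m => ?_)⟩, ?_⟩
    · refine section_ext_germ N U.unop _ _ fun z hz => ?_
      refine (germ_pushforwardPreimageApp f g U.unop z hz _).trans ?_
      refine (congrArg _ (germ_smul' M U.unop z hz r m)).trans ?_
      refine (pushforwardPreimage_stalk_smul f g z _ _).trans ?_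
      refine Eq.trans ?_ (germ_smul' N U.unop z hz r _).symm
      exact congrArg _ (germ_pushforwardPreimageApp f g U.unop z hz m).symm
    · ext U m
      refine section_ext_germ _ _ _ _ fun x hx => ?_
      by_cases hxz : x ∈ Set.range f
      · obtain ⟨z, rfl⟩ := hxz
        apply ((asIso (pushforwardStalk f N z)).addCommGroupIsoToAddEquiv).injective
        refine (pushforwardStalk_germ f N z U hx _).trans ?_
        refine (germ_pushforwardPreimageApp f g (f ⁻¹ᵁ U) z hx m).trans ?_
        rw [← germ_map]
        change _ = pushforwardStalk f N z _
        have := pushforwardStalk_germ f M z U hx m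
        refine (congrArg _ this.symm).trans ?_
        exact pushforwardTransport_apply f g z _
      · have := AddCommGrpCat.subsingleton_of_isZero (isZero_stalk_pushforward f N x hxz)
        exact Subsingleton.elim _ _

end PushforwardFull

/-! ### The sheaf of arbitrary families of elements of modules over the local rings -/

section Families

variable {Z : Scheme.{u}} (T : Z → Type u) [∀ z, AddCommGroup (T z)]
  [∀ z, Module (Z.presheaf.stalk z) (T z)]

/-- The presheaf of abelian groups of families of elements of `T z`. -/
def familyPresheaf : TopCat.Presheaf Ab.{u} Z where
  obj U := AddCommGrpCat.of (∀ z : U.unop, T z)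
  map i := AddCommGrpCat.ofHom
    { toFun s z := s ⟨z.1, i.unop.le z.2⟩
      map_zero' := rfl
      map_add' _ _ := rfl }

/-- Families of elements are modules over functions, which act through their germs. -/
abbrev familyModule (U : Z.Opens) : Module Γ(Z, U) (∀ z : U, T z) :=
  letI (z : U) : Module Γ(Z, U) (T z) := Module.compHom (T z) (Z.presheaf.germ U z.1 z.2).hom
  Pi.module _ _ _

/-- The sheaf of modules of families of elements of `T z`. -/
def familyModules : Z.Modules where
  val :=
    letI (U : (TopologicalSpace.Opens Z)ᵒᵖ) :
        Module (Z.ringCatSheaf.obj.obj U) ((familyPresheaf T).obj U) := familyModule T U.unop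
    PresheafOfModules.ofPresheaf (familyPresheaf T) (fun U V i r m => by
      funext z
      have h := TopCat.Presheaf.germ_res_apply Z.presheaf i.unop z.1 z.2 r
      exact (congrArg (fun r => r • m ⟨z.1, i.unop.le z.2⟩) h).symm)
  isSheaf := (TopCat.Presheaf.isSheaf_iff_isSheaf_comp (forget AddCommGrpCat)
    (familyPresheaf T)).2 (TopCat.Presheaf.toTypes_isSheaf Z.toTopCat T)

end Families

/-! ### Sheaves of modules killed by the equation of a closed subscheme. -/

lemma exists_module_of_surjective {R S M : Type*} [CommRing R] [CommRing S] [AddCommGroup M]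
    [Module R M] (φ : R →+* S) (hφ : Function.Surjective φ)
    (h : ∀ r ∈ RingHom.ker φ, ∀ m : M, r • m = 0) :
    ∃ _ : Module S M, ∀ (r : R) (m : M), φ r • m = r • m := by
  have ht : Module.IsTorsionBySet R M (RingHom.ker φ : Set R) := fun m r => h r r.2 m
  let := ht.module
  let e := RingHom.quotientKerEquivOfSurjective hφ
  refine ⟨Module.compHom M e.symm.toRingHom, fun r m => ?_⟩
  have : e.symm (φ r) = Ideal.Quotient.mk _ r := by
    rw [RingEquiv.symm_apply_eq]
    rfl
  change e.symm (φ r) • m = _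
  rw [this]
  rfl

lemma germ_smul_eq_zero {X : Scheme.{u}} {a : Γ(X, ⊤)} {Q : X.Modules}
    (hQ : mulHom a Q = 0) (x : X) (m : (stalkAb x).obj Q) :
    X.presheaf.germ ⊤ x trivial a • m = 0 := by
  rw [← mulHom_stalk, hQ, Functor.map_zero]
  rfl

/-- `f` is a closed immersion whose ideal is generated by the global function `a`. -/
structure IsCutOutBy {Z X : Scheme.{u}} (f : Z ⟶ X) (a : Γ(X, ⊤)) : Prop where
  isClosedImmersion : IsClosedImmersion f
  isUnit_germ : ∀ x : X, x ∉ Set.range f → IsUnit (X.presheaf.germ ⊤ x trivial a)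
  ker_stalkMap : ∀ z : Z, RingHom.ker (f.stalkMap z).hom =
    Ideal.span {X.presheaf.germ ⊤ (f z) trivial a}

namespace IsCutOutBy

variable {Z X : Scheme.{u}} {f : Z ⟶ X} {a : Γ(X, ⊤)} (hf : IsCutOutBy f a)

include hf

lemma appTop_eq_zero : f.appTop a = 0 := by
  refine TopCat.Presheaf.section_ext Z.sheaf ⊤ _ _ fun z hz => ?_
  have h : (f.stalkMap z).hom (X.presheaf.germ ⊤ (f z) trivial a) = 0 := by
    rw [← RingHom.mem_ker, hf.ker_stalkMap]
    exact Ideal.mem_span_singleton_self _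
  exact ((f.germ_stalkMap_apply ⊤ z trivial a).symm.trans h).trans
    (map_zero (Z.presheaf.germ ⊤ z hz).hom).symm

lemma exists_module {Q : X.Modules} (hQ : mulHom a Q = 0) (z : Z) :
    ∃ _ : Module (Z.presheaf.stalk z) ((stalkAb (f z)).obj Q),
      ∀ (r : X.presheaf.stalk (f z)) (m : (stalkAb (f z)).obj Q), f.stalkMap z r • m = r • m := by
  have := hf.isClosedImmersion
  refine exists_module_of_surjective (f.stalkMap z).hom (f.stalkMap_surjective z) ?_
  intro r hr m
  rw [hf.ker_stalkMap, Ideal.mem_span_singleton'] at hr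
  obtain ⟨b, rfl⟩ := hr
  rw [mul_smul, germ_smul_eq_zero hQ, smul_zero]

/-- The stalks of `Q` are modules over the local rings of `Z` at points of `Z`, and vanish
elsewhere. Taking germs thus embeds `Q` in the pushforward of the sheaf of families of elements of
these stalks. Any map to a pushforward factors through the unit, so the unit is a monomorphism too.
-/
lemma mono_unit {Q : X.Modules} (hQ : mulHom a Q = 0) :
    Mono ((Scheme.Modules.pullbackPushforwardAdjunction f).unit.app Q) := by
  choose inst hinst using hf.exists_module hQ
  let N : Z.Modules := familyModules (fun z => (stalkAb (f z)).obj Q)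
  let j : Q ⟶ (Scheme.Modules.pushforward f).obj N :=
    ⟨PresheafOfModules.homMk (M₁ := Q.val) (M₂ := ((Scheme.Modules.pushforward f).obj N).val)
      { app U := AddCommGrpCat.ofHom
          { toFun m := fun z : f ⁻¹ᵁ U.unop => germ Q U.unop (f z.1) z.2 m
            map_zero' := by funext z; exact map_zero _
            map_add' := fun m n => by funext z; exact map_add _ _ _ }
        naturality U V i := by
          ext m
          funext z
          exact germ_res Q i.unop (f z.1) z.2 m }
      (fun U r m => by
        funext z
        refine (germ_smul' Q U.unop (f z.1) z.2 r m).trans ?_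
        refine (hinst z.1 _ _).symm.trans ?_
        exact congrArg (fun r => r • germ Q U.unop (f z.1) z.2 m)
          (f.germ_stalkMap_apply U.unop z.1 z.2 r))⟩
  have hj : ∀ (U : X.Opens) (m : Γ(Q, U)) (z : Z) (hz : f z ∈ U),
      (show ∀ z : f ⁻¹ᵁ U, (stalkAb (f z.1)).obj Q from j.app U m) ⟨z, hz⟩ =
        germ Q U (f z) hz m := fun U m z hz => rfl
  have hmono : Mono j := by
    refine ⟨fun {L} g h e => ?_⟩
    ext U s
    refine section_ext_germ _ _ _ _ fun x hx => ?_
    by_cases hxz : x ∈ Set.range f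
    · obtain ⟨z, rfl⟩ := hxz
      rw [← hj U _ z hx, ← hj U _ z hx]
      have e' : j.app U (g.app U s) = j.app U (h.app U s) :=
        ConcreteCategory.congr_hom (congrArg (fun k => Scheme.Modules.Hom.app k U) e) s
      rw [e']
    · have h0 : ∀ m : (stalkAb x).obj Q, m = 0 := fun m => by
        obtain ⟨b, hb⟩ := (hf.isUnit_germ x hxz).exists_left_inv
        rw [← one_smul (X.presheaf.stalk x) m, ← hb, mul_smul, germ_smul_eq_zero hQ, smul_zero]
      rw [h0 (germ Q U x hx _), h0 (germ Q U x hx (h.app U s))]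
  have hfac : (Scheme.Modules.pullbackPushforwardAdjunction f).unit.app Q ≫
      (Scheme.Modules.pushforward f).map
        (((Scheme.Modules.pullbackPushforwardAdjunction f).homEquiv _ _).symm j) = j :=
    (Adjunction.homEquiv_unit _ _ _ _).symm.trans (Equiv.apply_symm_apply _ _)
  exact mono_of_mono_fac hfac

lemma mulHom_pushforward (N : Z.Modules) : mulHom a ((Scheme.Modules.pushforward f).obj N) = 0 := by
  rw [← pushforward_map_mulHom, hf.appTop_eq_zero, mulHom_zero, Functor.map_zero]

/-- The cokernel of the unit is also killed by `a`, so by `mono_unit` it embeds in a pushforward. By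
fullness the resulting map from the pushforward of the pullback of `Q` is the pushforward of some
`h`; the transpose of `h` starts with the unit followed by its cokernel, so `h = 0` and the cokernel
vanishes. -/
lemma isIso_unit {Q : X.Modules} (hQ : mulHom a Q = 0) :
    IsIso ((Scheme.Modules.pullbackPushforwardAdjunction f).unit.app Q) := by
  have := hf.isClosedImmersion
  let adj := Scheme.Modules.pullbackPushforwardAdjunction f
  have h1 : Mono (adj.unit.app Q) := hf.mono_unit hQ
  let p := cokernel.π (adj.unit.app Q)
  have hC : mulHom a (cokernel (adj.unit.app Q)) = 0 := by
    rw [← cancel_epi p, ← mulHom_naturality]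
    have : mulHom a ((Scheme.Modules.pullback f ⋙ Scheme.Modules.pushforward f).obj Q) = 0 :=
      hf.mulHom_pushforward _
    rw [this, zero_comp, comp_zero]
  have h2 : Mono (adj.unit.app (cokernel (adj.unit.app Q))) := hf.mono_unit hC
  obtain ⟨h, hh⟩ := (Scheme.Modules.pushforward f).map_surjective
    (p ≫ adj.unit.app (cokernel (adj.unit.app Q)))
  have h3 : h = 0 := by
    apply (adj.homEquiv _ _).injective
    rw [Adjunction.homEquiv_unit, Adjunction.homEquiv_unit, hh, Functor.map_zero, comp_zero,
      cokernel.condition_assoc, zero_comp]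
  have h4 : p = 0 := by
    rw [← cancel_mono (adj.unit.app (cokernel (adj.unit.app Q))), ← hh, h3, Functor.map_zero,
      zero_comp]
  have h5 : Epi (adj.unit.app Q) := Abelian.epi_of_cokernel_π_eq_zero _ h4
  exact isIso_of_mono_of_epi _

/-- The unit of the adjunction is surjective with kernel the image of multiplication by `a`. -/
lemma exact_unit (M : X.Modules) (w : mulHom a M ≫
      (Scheme.Modules.pullbackPushforwardAdjunction f).unit.app M = 0) :
    (ShortComplex.mk (mulHom a M)
      ((Scheme.Modules.pullbackPushforwardAdjunction f).unit.app M) w).Exact ∧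
    Epi ((Scheme.Modules.pullbackPushforwardAdjunction f).unit.app M) := by
  let adj := Scheme.Modules.pullbackPushforwardAdjunction f
  let p := cokernel.π (mulHom a M)
  have hQ : mulHom a (cokernel (mulHom a M)) = 0 := by
    rw [← cancel_epi p, ← mulHom_naturality, cokernel.condition, comp_zero]
  have h1 : IsIso (adj.unit.app (cokernel (mulHom a M))) := hf.isIso_unit hQ
  -- Pullback is right exact and turns multiplication by `a` into zero, so `M` and `M/aM` have the
  -- same pullback. This reduces the claim to `M/aM`, which is killed by `a`.
  have h2 : IsIso ((Scheme.Modules.pullback f).map p) := by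
    have : PreservesColimits (Scheme.Modules.pullback f) := adj.leftAdjoint_preservesColimits
    have h0 : (Scheme.Modules.pullback f).map (mulHom a M) = 0 := by
      rw [pullback_map_mulHom, hf.appTop_eq_zero, mulHom_zero]
    have hc := isColimitCoforkMapOfIsColimit' (Scheme.Modules.pullback f)
      (cokernel.condition (mulHom a M))
      (cokernelIsCokernel _)
    exact isIso_colimit_cocone_parallelPair_of_eq h0 hc
  have h3 : adj.unit.app M ≫ (Scheme.Modules.pushforward f).map ((Scheme.Modules.pullback f).map p)
      = p ≫ adj.unit.app (cokernel (mulHom a M)) := adj.unit_naturality p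
  have h4 : adj.unit.app M = p ≫ adj.unit.app (cokernel (mulHom a M)) ≫
      inv ((Scheme.Modules.pushforward f).map ((Scheme.Modules.pullback f).map p)) := by
    rw [← Category.assoc, ← h3, Category.assoc, IsIso.hom_inv_id]
    exact (Category.comp_id _).symm
  refine ⟨?_, by
    change Epi (adj.unit.app M)
    rw [h4]; infer_instance⟩
  refine ShortComplex.exact_of_g_is_cokernel _ ?_
  refine (cokernelIsCokernel (mulHom a M)).ofIsoColimit
    (Cofork.ext (asIso (adj.unit.app (cokernel (mulHom a M)) ≫
      inv ((Scheme.Modules.pushforward f).map ((Scheme.Modules.pullback f).map p)))) ?_)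
  exact h4.symm

lemma isIso_counit (N : Z.Modules) :
    IsIso ((Scheme.Modules.pullbackPushforwardAdjunction f).counit.app N) := by
  have := hf.isClosedImmersion
  infer_instance

end IsCutOutBy

/-! ### Finite presentations -/

section FinitePresentation

open SheafOfModules TopologicalSpace

lemma presentation_map_isFinite {C D : Type u} [SmallCategory C] [SmallCategory D]
    {J : GrothendieckTopology C} {K : GrothendieckTopology D} {R : Sheaf J RingCat.{u}}
    {S : Sheaf K RingCat.{u}} [HasSheafify J AddCommGrpCat.{u}]
    [J.WEqualsLocallyBijective AddCommGrpCat.{u}] [HasSheafify K AddCommGrpCat.{u}]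
    [K.WEqualsLocallyBijective AddCommGrpCat.{u}] {M : SheafOfModules.{u} R}
    (P : Presentation M) (hP : P.IsFinite)
    (F : SheafOfModules.{u} R ⥤ SheafOfModules.{u} S) [PreservesColimitsOfSize.{u, u} F]
    (η : unit S ≅ F.obj (unit R)) : (P.map F η).IsFinite where
  isFiniteType_generators := ⟨inferInstanceAs (Finite P.generators.I)⟩
  isFiniteType_relations := ⟨inferInstanceAs (Finite P.relations.I)⟩

lemma presentation_ofIsIso_isFinite {C : Type u} [SmallCategory C]
    {J : GrothendieckTopology C} {R : Sheaf J RingCat.{u}} [HasSheafify J AddCommGrpCat.{u}]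
    [J.WEqualsLocallyBijective AddCommGrpCat.{u}] {M N : SheafOfModules.{u} R}
    (P : Presentation M) (hP : P.IsFinite) (f : M ⟶ N) [IsIso f] : (P.ofIsIso f).IsFinite :=
  inferInstance

variable {X Y : Scheme.{u}}

/-- The sheaf of modules admits a global finite presentation. -/
def HasFinPres (M : X.Modules) : Prop :=
  ∃ p : Presentation (R := X.ringCatSheaf) M, p.IsFinite

lemma HasFinPres.of_iso {M N : X.Modules} (h : HasFinPres M) (e : M ≅ N) : HasFinPres N := by
  obtain ⟨p, hp⟩ := h
  let e' : @Quiver.Hom (SheafOfModules X.ringCatSheaf) _ M N := e.hom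
  have : IsIso e' := inferInstanceAs (IsIso e.hom)
  exact ⟨_, presentation_ofIsIso_isFinite p hp e'⟩

lemma HasFinPres.map {M : X.Modules} (h : HasFinPres M) (F : X.Modules ⥤ Y.Modules)
    [F.IsLeftAdjoint] (η : F.obj (unit X.ringCatSheaf) ≅ unit Y.ringCatSheaf) :
    HasFinPres (F.obj M) := by
  obtain ⟨p, hp⟩ := h
  have h1 : PreservesColimitsOfSize.{u, u} F := inferInstance
  let F' : SheafOfModules.{u} X.ringCatSheaf ⥤ SheafOfModules.{u} Y.ringCatSheaf := F
  have : PreservesColimitsOfSize.{u, u} F' := h1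
  let η' : F'.obj (unit X.ringCatSheaf) ≅ unit Y.ringCatSheaf := η
  exact ⟨_, presentation_map_isFinite p hp F' η'.symm⟩

lemma HasFinPres.restrict {M : X.Modules} (h : HasFinPres M) (f : Y ⟶ X) [IsOpenImmersion f] :
    HasFinPres (M.restrict f) :=
  h.map (Scheme.Modules.restrictFunctor f) (Scheme.Modules.restrictUnitIso f)

/-- The whole space is terminal in each comma category. Finality is what identifies the pullback of
the structure sheaf with the structure sheaf. -/
instance (f : Y ⟶ X) : (Opens.map f.base).Final := by
  refine ⟨fun U => ?_⟩
  let T : StructuredArrow U (Opens.map f.base) := StructuredArrow.mk (Y := ⊤) (homOfLE le_top)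
  have hT : IsTerminal T := IsTerminal.ofUniqueHom
    (fun V => StructuredArrow.homMk (homOfLE le_top) rfl) (fun V g => by
      ext
      exact Subsingleton.elim _ _)
  have := hT.hasTerminal
  exact isConnected_of_hasTerminal _

/-- The pullback of the structure sheaf is the structure sheaf. -/
def pullbackUnitIso (f : Y ⟶ X) :
    (Scheme.Modules.pullback f).obj (unit X.ringCatSheaf) ≅ unit Y.ringCatSheaf :=
  haveI : (SheafOfModules.pushforward.{u} f.toRingCatSheafHom).IsRightAdjoint :=
    (Scheme.Modules.pullbackPushforwardAdjunction f).isRightAdjoint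
  haveI h := SheafOfModules.instIsIsoPullbackObjUnitToUnitOfFinal.{u} f.toRingCatSheafHom
  @asIso (SheafOfModules.{u} Y.ringCatSheaf) _ _ _
    (SheafOfModules.pullbackObjUnitToUnit.{u} f.toRingCatSheafHom) h

lemma HasFinPres.pullback {M : X.Modules} (h : HasFinPres M) (f : Y ⟶ X) :
    HasFinPres ((Scheme.Modules.pullback f).obj M) :=
  h.map (Scheme.Modules.pullback f) (pullbackUnitIso f)

/-- The sheaf of modules has a finite presentation in an affine neighbourhood of each point. -/
def LocallyFinPres (M : X.Modules) : Prop :=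
  ∀ x : X, ∃ (A : CommRingCat.{u}) (f : Spec A ⟶ X) (_ : IsOpenImmersion f),
    x ∈ Set.range f ∧ HasFinPres (M.restrict f)

/-- Coherence is defined by presentations over slice sites. The equivalence between modules on the
slice over `W i` and on the open subscheme `W i` turns them into presentations that restrict to
affine opens. -/
lemma IsCoherent.locallyFinPres {M : X.Modules} (h : IsCoherent M) : LocallyFinPres M := by
  obtain ⟨⟨I, W, cov, pres⟩, ⟨fin⟩⟩ := h.exists_quasicoherentData
  change I → X.Opens at W
  intro x
  rw [Opens.coversTop_iff] at cov
  obtain ⟨i, hi⟩ := Opens.mem_iSup.1 (cov.symm ▸ Opens.mem_top x)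
  let F := (Scheme.Modules.overEquiv (W i)).functor
  have hF : PreservesColimitsOfSize.{u, u} F := inferInstance
  let F' : SheafOfModules.{u} (X.ringCatSheaf.over (W i)) ⥤
    SheafOfModules.{u} (W i).toScheme.ringCatSheaf := F
  have : PreservesColimitsOfSize.{u, u} F' := hF
  have h1 : HasFinPres (M.restrict (W i).ι) :=
    HasFinPres.of_iso ⟨_, presentation_map_isFinite (pres i) (fin i) F' (Iso.refl _)⟩
      ((Scheme.Modules.overFunctorEquiv (W i)).app M)
  obtain ⟨V, hV, hxV, -⟩ :
      ∃ V : (W i).toScheme.Opens, IsAffineOpen V ∧ (⟨x, hi⟩ : (W i).toScheme) ∈ V ∧ True := by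
    obtain ⟨V, hV, hxV, -⟩ := Opens.isBasis_iff_nbhd.1 (W i).toScheme.isBasis_affineOpens
      (Opens.mem_top (⟨x, hi⟩ : (W i).toScheme))
    exact ⟨V, hV, hxV, trivial⟩
  refine ⟨_, IsAffineOpen.fromSpec hV ≫ (W i).ι, inferInstance, ?_,
    (h1.restrict (IsAffineOpen.fromSpec hV)).of_iso
      ((Scheme.Modules.restrictFunctorComp _ _).app M).symm⟩
  have : (⟨x, hi⟩ : (W i).toScheme) ∈ Set.range (IsAffineOpen.fromSpec hV) := by
    rw [IsAffineOpen.range_fromSpec]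
    exact hxV
  obtain ⟨y, hy⟩ := this
  exact ⟨y, by rw [Scheme.Hom.comp_apply, hy]; rfl⟩

lemma LocallyFinPres.isCoherent {M : X.Modules} (h : LocallyFinPres M) : IsCoherent M := by
  choose A f hf hx hM using h
  let U : X → X.Opens := fun x => (f x).opensRange
  have hU : ∀ x, HasFinPres (M.restrict (U x).ι) := fun x => by
    refine ((hM x).restrict (Scheme.Hom.isoOpensRange (f x)).inv).of_iso
      ((Scheme.Modules.restrictFunctorComp _ _).symm.app M ≪≫
        (Scheme.Modules.restrictFunctorCongr ?_).app M)
    exact Scheme.Hom.isoOpensRange_inv_comp (f x)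
  have key : ∀ x, ∃ p : Presentation (M.over (U x)), p.IsFinite := fun x => by
    obtain ⟨p, hp⟩ := hU x
    let F := (Scheme.Modules.overEquiv (U x)).inverse
    have hF : PreservesColimitsOfSize.{u, u} F := inferInstance
    let F' : SheafOfModules.{u} (U x).toScheme.ringCatSheaf ⥤
      SheafOfModules.{u} (X.ringCatSheaf.over (U x)) := F
    have : PreservesColimitsOfSize.{u, u} F' := hF
    let η : unit _ ≅ F'.obj (unit _) :=
      ((U x).sheafOfModulesEquivOverInverseUnit X.ringCatSheaf).symm
    let e : F'.obj (M.restrict (U x).ι) ≅ M.over (U x) :=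
      F.mapIso ((Scheme.Modules.overFunctorEquiv (U x)).app M).symm ≪≫
        ((Scheme.Modules.overEquiv (U x)).unitIso.app (M.over (U x))).symm
    exact ⟨_, presentation_ofIsIso_isFinite _ (presentation_map_isFinite p hp F' η) e.hom⟩
  choose p hp using key
  have hc : (Opens.grothendieckTopology X).CoversTop U := ?_
  · let σ : QuasicoherentData.{u} (R := X.ringCatSheaf) M :=
      { I := X, X := U, coversTop := hc, presentation := p }
    have hσ : σ.IsFinitePresentation := { isFinite_presentation := hp }
    change SheafOfModules.IsFinitePresentation.{u} (R := X.ringCatSheaf) M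
    exact { exists_quasicoherentData := ⟨σ, hσ⟩ }
  rw [Opens.coversTop_iff]
  refine eq_top_iff.2 fun x _ => Opens.mem_iSup.2 ⟨x, hx x⟩

lemma isCoherent_iff (M : X.Modules) : IsCoherent M ↔ LocallyFinPres M :=
  ⟨fun h => h.locallyFinPres, fun h => h.isCoherent⟩

lemma IsCoherent.of_iso {M N : X.Modules} (h : IsCoherent M) (e : M ≅ N) : IsCoherent N := by
  rw [isCoherent_iff] at h ⊢
  intro x
  obtain ⟨A, f, hf, hx, hM⟩ := h x
  exact ⟨A, f, hf, hx, hM.of_iso ((Scheme.Modules.restrictFunctor f).mapIso e)⟩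

lemma IsCoherent.pullback {M : X.Modules} (h : IsCoherent M) (f : Y ⟶ X) :
    IsCoherent ((Scheme.Modules.pullback f).obj M) := by
  rw [isCoherent_iff] at h ⊢
  intro y
  obtain ⟨A, i, hi, hx, hM⟩ := h (f y)
  obtain ⟨V, hV, hyV, hVU⟩ := Opens.isBasis_iff_nbhd.1 Y.isBasis_affineOpens
    (show y ∈ f ⁻¹ᵁ i.opensRange from hx)
  let j := IsAffineOpen.fromSpec hV
  have hj : Set.range j = V := IsAffineOpen.range_fromSpec hV
  have : IsOpenImmersion j := IsAffineOpen.isOpenImmersion_fromSpec hV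
  have hr : Set.range (j ≫ f) ⊆ Set.range i := by
    rintro _ ⟨z, rfl⟩
    have : j z ∈ V := by
      have : j z ∈ Set.range j := ⟨z, rfl⟩
      rwa [hj] at this
    exact hVU this
  let g := IsOpenImmersion.lift i (j ≫ f) hr
  have hg : g ≫ i = j ≫ f := IsOpenImmersion.lift_fac _ _ _
  refine ⟨_, j, inferInstance, by rw [hj]; exact hyV, ?_⟩
  refine (hM.pullback g).of_iso ?_
  exact (Scheme.Modules.pullback g).mapIso
      ((Scheme.Modules.restrictFunctorIsoPullback i).app M) ≪≫
    (Scheme.Modules.pullbackComp g i).app M ≪≫ (Scheme.Modules.pullbackCongr hg).app M ≪≫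
    ((Scheme.Modules.pullbackComp j f).app M).symm ≪≫
    ((Scheme.Modules.restrictFunctorIsoPullback j).app _).symm

end FinitePresentation

/-! ### Finitely presented sheaves of modules on affine Noetherian schemes -/

section TildeFunctor

open TopologicalSpace

variable {A : CommRingCat.{u}}

/-- Sections over a basic open form a localisation of the module, and localisation preserves
injectivity. -/
lemma tilde_map_app_injective {M N : ModuleCat.{u} A} (f : M ⟶ N) [Mono f] (g : A) :
    Function.Injective ((modulesSpecToSheaf.map (tilde.map f)).1.app
      (.op (PrimeSpectrum.basicOpen g))).hom := by
  have hf : Function.Injective f.hom := (ModuleCat.mono_iff_injective f).1 inferInstance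
  have h1 := IsLocalizedModule.map_injective (.powers g)
    (tilde.toOpen M (PrimeSpectrum.basicOpen g)).hom
    (tilde.toOpen N (PrimeSpectrum.basicOpen g)).hom f.hom hf
  have h2 : IsLocalizedModule.map (.powers g)
    (tilde.toOpen M (PrimeSpectrum.basicOpen g)).hom
    (tilde.toOpen N (PrimeSpectrum.basicOpen g)).hom f.hom =
    ((modulesSpecToSheaf.map (tilde.map f)).1.app (.op (PrimeSpectrum.basicOpen g))).hom := by
    refine IsLocalizedModule.ext (.powers g)
      (tilde.toOpen M (PrimeSpectrum.basicOpen g)).hom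
      (IsLocalizedModule.map_units (tilde.toOpen N (PrimeSpectrum.basicOpen g)).hom) ?_
    refine (IsLocalizedModule.map_comp (.powers g) _ _ f.hom).trans ?_
    exact (congrArg ModuleCat.Hom.hom
      (tilde.toOpen_map_app f (PrimeSpectrum.basicOpen g))).symm
  rw [h2] at h1
  exact h1

instance : (tilde.functor A).PreservesMonomorphisms where
  preserves {M N} f _ := by
    rw [mono_iff_stalk]
    intro x
    rw [AddCommGrpCat.mono_iff_injective]
    refine (injective_iff_map_eq_zero _).2 fun a ha => ?_
    obtain ⟨U, hx, s, rfl⟩ := exists_germ_eq _ x a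
    have h0 : germ ((tilde.functor A).obj N) U x hx (((tilde.functor A).map f).app U s) =
        germ ((tilde.functor A).obj N) U x hx 0 := by
      rw [← germ_map, ha, map_zero]
    obtain ⟨W, hW, iU, iV, h1⟩ := germ_eq_iff _ x hx hx _ _ h0
    obtain ⟨_, ⟨_, ⟨g, rfl⟩, rfl⟩, hxg, hg⟩ :=
      PrimeSpectrum.isBasis_basic_opens.exists_subset_of_mem_open hW W.2
    let V : (Spec A).Opens := PrimeSpectrum.basicOpen g
    let j : V ⟶ W := homOfLE hg
    have e1 : ((tilde.functor A).map f).app V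
        (((tilde.functor A).obj M).presheaf.map (j ≫ iU).op s) =
        ((tilde.functor A).obj N).presheaf.map (j ≫ iU).op (((tilde.functor A).map f).app U s) :=
      congr($(((tilde.functor A).map f).mapPresheaf.naturality (j ≫ iU).op) s)
    have e2 : ((tilde.functor A).obj N).presheaf.map (j ≫ iU).op
        (((tilde.functor A).map f).app U s) = 0 := by
      rw [op_comp, Functor.map_comp, ConcreteCategory.comp_apply, h1, map_zero, map_zero]
    have key : ((tilde.functor A).obj M).presheaf.map (j ≫ iU).op s = 0 :=
      tilde_map_app_injective f g ((e1.trans e2).trans (map_zero _).symm)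
    refine (germ_res _ (j ≫ iU) x hxg s).symm.trans ?_
    exact (congrArg _ key).trans (map_zero _)

lemma preservesFiniteLimits_of_preservesMonomorphisms {C D : Type*} [Category* C] [Category* D]
    [Abelian C] [Abelian D] (F : C ⥤ D) [F.Additive] [PreservesFiniteColimits F]
    [F.PreservesMonomorphisms] : PreservesFiniteLimits F := by
  refine ((Functor.preservesFiniteLimits_tfae F).out 0 3).1 fun S hS => ?_
  have := hS.mono_f
  have h : PreservesFiniteColimits F := inferInstance
  have h' : ∀ S : ShortComplex C, S.ShortExact → (S.map F).Exact ∧ Epi (F.map S.g) :=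
    ((Functor.preservesFiniteColimits_tfae F).out 0 3).2 h
  exact ⟨(h' S hS).1, F.map_mono S.f⟩

instance : PreservesFiniteLimits (tilde.functor A) :=
  preservesFiniteLimits_of_preservesMonomorphisms _

end TildeFunctor

section HasFinPres

variable {A : CommRingCat.{u}}

/-- The functor `tilde` is fully faithful, so the relations between the two free sheaves come from a
map of free modules; it preserves cokernels, so the cokernel of that map represents `M`. -/
lemma HasFinPres.exists_tilde {M : (Spec A).Modules} (h : HasFinPres M) :
    ∃ N : ModuleCat.{u} A, Module.Finite A N ∧ Nonempty (M ≅ (tilde.functor A).obj N) := by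
  obtain ⟨P, hP⟩ := h
  have : Finite P.generators.I := hP.isFiniteType_generators.finite
  let F₁ : (Spec A).Modules := SheafOfModules.free P.relations.I
  let F₀ : (Spec A).Modules := SheafOfModules.free P.generators.I
  let r' : @Quiver.Hom (SheafOfModules.{u} (Spec A).ringCatSheaf) _ F₁ F₀ :=
    P.relations.π ≫ kernel.ι _
  let r : F₁ ⟶ F₀ := r'
  let iso' : cokernel r' ≅ M := IsColimit.coconePointUniqueUpToIso (colimit.isColimit _) P.isColimit
  let iso₀ : cokernel r ≅ M := iso'
  let e₁ : (tilde.functor A).obj (ModuleCat.of A (P.relations.I →₀ A)) ≅ F₁ := tildeFinsupp _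
  let e₀ : (tilde.functor A).obj (ModuleCat.of A (P.generators.I →₀ A)) ≅ F₀ := tildeFinsupp _
  let g := (tilde.functor A).preimage (e₁.hom ≫ r ≫ e₀.inv)
  let iso : cokernel ((tilde.functor A).map g) ≅ cokernel r := by
    refine cokernel.mapIso _ _ e₁ e₀ ?_
    rw [(tilde.functor A).map_preimage]
    simp
  have hN : Module.Finite A (cokernel g : ModuleCat.{u} A) :=
    Module.Finite.of_surjective (cokernel.π g).hom
      ((ModuleCat.epi_iff_surjective _).1 inferInstance)
  exact ⟨cokernel g, hN,
    ⟨(PreservesCokernel.iso (tilde.functor A) g ≪≫ iso ≪≫ iso₀).symm⟩⟩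

variable [IsNoetherianRing A]

lemma hasFinPres_tilde (N : ModuleCat.{u} A) [hN : Module.Finite A N] :
    HasFinPres ((tilde.functor A).obj N) := by
  obtain ⟨s, hs⟩ := hN.1
  let S : Set N := s
  obtain ⟨t, ht⟩ := IsNoetherian.noetherian
    (LinearMap.ker (Finsupp.linearCombination A ((↑) : S → N)))
  have h1 : Finite S := s.finite_toSet
  have h2 : Finite (t : Set (S →₀ A)) := t.finite_toSet
  exact ⟨presentationTilde N S hs (t : Set (S →₀ A)) ht,
    { isFiniteType_generators := ⟨h1⟩
      isFiniteType_relations := ⟨h2⟩ }⟩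

lemma HasFinPres.kernel {M N : (Spec A).Modules} (hM : HasFinPres M) (hN : HasFinPres N)
    (f : M ⟶ N) : HasFinPres (kernel f) := by
  obtain ⟨M', hM', ⟨e⟩⟩ := hM.exists_tilde
  obtain ⟨N', hN', ⟨e'⟩⟩ := hN.exists_tilde
  let g := (tilde.functor A).preimage (e.inv ≫ f ≫ e'.hom)
  have : Module.Finite A (Limits.kernel g : ModuleCat.{u} A) :=
    Module.Finite.of_injective (kernel.ι g).hom
      ((ModuleCat.mono_iff_injective _).1 inferInstance)
  exact (hasFinPres_tilde (Limits.kernel g)).of_iso (PreservesKernel.iso (tilde.functor A) g ≪≫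
    (kernel.mapIso f _ e e' (by rw [(tilde.functor A).map_preimage]; simp)).symm)

lemma HasFinPres.cokernel {M N : (Spec A).Modules} (hM : HasFinPres M) (hN : HasFinPres N)
    (f : M ⟶ N) : HasFinPres (cokernel f) := by
  obtain ⟨M', hM', ⟨e⟩⟩ := hM.exists_tilde
  obtain ⟨N', hN', ⟨e'⟩⟩ := hN.exists_tilde
  let g := (tilde.functor A).preimage (e.inv ≫ f ≫ e'.hom)
  have : Module.Finite A (Limits.cokernel g : ModuleCat.{u} A) :=
    Module.Finite.of_surjective (cokernel.π g).hom
      ((ModuleCat.epi_iff_surjective _).1 inferInstance)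
  exact (hasFinPres_tilde (Limits.cokernel g)).of_iso (PreservesCokernel.iso (tilde.functor A) g ≪≫
    (cokernel.mapIso f _ e e' (by rw [(tilde.functor A).map_preimage]; simp)).symm)

lemma HasFinPres.biprod {M N : (Spec A).Modules} (hM : HasFinPres M) (hN : HasFinPres N) :
    HasFinPres (M ⊞ N) := by
  obtain ⟨M', hM', ⟨e⟩⟩ := hM.exists_tilde
  obtain ⟨N', hN', ⟨e'⟩⟩ := hN.exists_tilde
  have : Module.Finite A (M' ⊞ N' : ModuleCat.{u} A) :=
    Module.Finite.equiv (ModuleCat.biprodIsoProd M' N').symm.toLinearEquiv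
  have := preservesBinaryBiproducts_of_preservesBiproducts (tilde.functor A)
  exact (hasFinPres_tilde (M' ⊞ N')).of_iso ((tilde.functor A).mapBiprod M' N' ≪≫
    (biprod.mapIso e e').symm)

end HasFinPres

/-! ### Coherent sheaves on locally Noetherian schemes -/

section RestrictExact

variable {X Y : Scheme.{u}} (f : Y ⟶ X) [IsOpenImmersion f]

instance : (Scheme.Modules.restrictFunctor f).PreservesMonomorphisms where
  preserves {M N} g hg := by
    rw [mono_iff_stalk]
    intro y
    let e : Scheme.Modules.restrictFunctor f ⋙ stalkAb y ≅ stalkAb (f y) :=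
      Scheme.Modules.restrictStalkNatIso f y
    have h : (stalkAb y).map ((Scheme.Modules.restrictFunctor f).map g) =
        e.hom.app M ≫ (stalkAb (f y)).map g ≫ e.inv.app N := by
      rw [← e.hom.naturality_assoc]
      simp
    rw [h]
    infer_instance

instance : (Scheme.Modules.restrictFunctor f).Additive :=
  (Scheme.Modules.restrictAdjunction f).left_adjoint_additive

instance : PreservesFiniteColimits (Scheme.Modules.restrictFunctor f) := inferInstance

instance : PreservesFiniteLimits (Scheme.Modules.restrictFunctor f) :=
  preservesFiniteLimits_of_preservesMonomorphisms _

end RestrictExact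

section Lift

open TopologicalSpace

variable {A : CommRingCat.{u}}

lemma exists_hom_of_family (n : ℕ) (G : ModuleCat.{u} A) (s : Fin n → G) :
    ∃ e : ModuleCat.of A (Fin n → A) ⟶ G, ∀ i, e.hom (Pi.basisFun A (Fin n) i) = s i :=
  ⟨ModuleCat.ofHom ((Pi.basisFun A (Fin n)).constr A s),
    fun i => (Pi.basisFun A (Fin n)).constr_basis A s i⟩

/-- A map from a free sheaf is a choice of `n` sections, and an epimorphism lifts finitely many
sections near `x`. Quantifying over `j` leaves room to shrink the neighbourhood to an affine one. -/
lemma exists_lift_of_epi {M N : (Spec A).Modules} (g : M ⟶ N) [Epi g] (n : ℕ)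
    (p : (tilde.functor A).obj (ModuleCat.of A (Fin n → A)) ⟶ N) (x : Spec A) :
    ∃ (U : (Spec A).Opens), x ∈ U ∧ ∀ {Z : Scheme.{u}} (j : Z ⟶ Spec A) [IsOpenImmersion j],
      Set.range j ⊆ U →
        ∃ e : Scheme.Modules.restrict ((tilde.functor A).obj (ModuleCat.of A (Fin n → A))) j ⟶ M.restrict j,
        e ≫ (Scheme.Modules.restrictFunctor j).map g =
          (Scheme.Modules.restrictFunctor j).map p := by
  let t : Fin n → Γ(N, ⊤) := fun i =>
    ((tilde.adjunction.homEquiv _ _ p).hom (Pi.single i 1) : moduleSpecΓFunctor.obj N)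
  have h1 : ∀ i, ∃ (U : (Spec A).Opens) (_ : x ∈ U) (s : Γ(M, U)),
      g.app U s = N.presheaf.map (homOfLE le_top).op (t i) := fun i => by
    have : Epi ((stalkAb x).map g) := (epi_iff_stalk g).1 inferInstance x
    obtain ⟨a, ha⟩ := (AddCommGrpCat.epi_iff_surjective _).1 this
      (germ N ⊤ x (Opens.mem_top x) (t i))
    obtain ⟨U, hU, s, rfl⟩ := exists_germ_eq M x a
    rw [germ_map] at ha
    obtain ⟨W, hW, iU, iV, h⟩ := germ_eq_iff N x hU (Opens.mem_top x) _ _ ha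
    refine ⟨W, hW, M.presheaf.map iU.op s, ?_⟩
    refine Eq.trans ?_ h
    exact congr($(g.mapPresheaf.naturality iU.op) s)
  choose U hx s hs using h1
  refine ⟨⟨⋂ i, U i, isOpen_iInter_of_finite fun i => (U i).2⟩, Set.mem_iInter.2 hx,
    fun {Z} j _ hj => ?_⟩
  have hle : ∀ i, j ''ᵁ (j ⁻¹ᵁ ⊤) ≤ U i := fun i => by
    rintro _ ⟨z, -, rfl⟩
    exact Set.mem_iInter.1 (hj ⟨z, rfl⟩) i
  -- Passing to the pushforward of `M.restrict j` returns the problem to `Spec A`, where a map from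
  -- the free sheaf is given by the global sections `s'`.
  let adj := Scheme.Modules.restrictAdjunction j
  let M' : (Spec A).Modules := (Scheme.Modules.pushforward j).obj (M.restrict j)
  let G : ModuleCat.{u} A := moduleSpecΓFunctor.obj M'
  let s' : Fin n → G := fun i =>
    M.presheaf.map (homOfLE (hle i)).op (s i)
  obtain ⟨e₀, he₀⟩ := exists_hom_of_family n G s'
  let e₁ : (tilde.functor A).obj (ModuleCat.of A (Fin n → A)) ⟶ M' :=
    (tilde.adjunction.homEquiv _ _).symm e₀
  refine ⟨(adj.homEquiv _ _).symm e₁, ?_⟩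
  apply (adj.homEquiv _ _).injective
  rw [Adjunction.homEquiv_naturality_right, Equiv.apply_symm_apply, Adjunction.homEquiv_unit]
  have hn := adj.unit.naturality p
  refine Eq.trans ?_ hn
  apply (tilde.adjunction.homEquiv _ _).injective
  rw [Adjunction.homEquiv_naturality_right, Equiv.apply_symm_apply]
  refine Eq.trans ?_ (Adjunction.homEquiv_naturality_right _ _ _).symm
  refine ModuleCat.hom_ext ((Pi.basisFun A (Fin n)).ext fun i => ?_)
  have ht : t i = (tilde.adjunction.homEquiv _ _ p).hom (Pi.basisFun A (Fin n) i) := by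
    rw [Pi.basisFun_apply]
  have e2 : g.app _ (M.presheaf.map (homOfLE (hle i)).op (s i)) =
      N.presheaf.map (homOfLE (hle i)).op (g.app _ (s i)) :=
    congr($(g.mapPresheaf.naturality (homOfLE (hle i)).op) (s i))
  have e3 : N.presheaf.map (homOfLE (hle i)).op (N.presheaf.map (homOfLE le_top).op (t i)) =
      N.presheaf.map (homOfLE (le_top : j ''ᵁ (j ⁻¹ᵁ ⊤) ≤ ⊤)).op (t i) := by
    rw [← ConcreteCategory.comp_apply, ← Functor.map_comp]
    rfl
  have e4 : g.app _ (M.presheaf.map (homOfLE (hle i)).op (s i)) =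
    N.presheaf.map (homOfLE (le_top : j ''ᵁ (j ⁻¹ᵁ ⊤) ≤ ⊤)).op (t i) := by
    rw [e2, hs, e3]
  rw [ht] at e4
  refine Eq.trans ?_ e4
  exact congrArg (fun z => g.app (j ''ᵁ (j ⁻¹ᵁ ⊤)) z) (he₀ i)

end Lift

section Coherent

open TopologicalSpace

variable {X : Scheme.{u}}

lemma HasFinPres.restrict_of_range {Y Z : Scheme.{u}} {M : X.Modules} {f : Y ⟶ X}
    [IsOpenImmersion f] (h : HasFinPres (M.restrict f)) (j : Z ⟶ X) [IsOpenImmersion j]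
    (hj : Set.range j ⊆ Set.range f) : HasFinPres (M.restrict j) := by
  let g := IsOpenImmersion.lift f j hj
  have hg : g ≫ f = j := IsOpenImmersion.lift_fac _ _ _
  have : IsOpenImmersion g := by
    have : IsOpenImmersion (g ≫ f) := by rwa [hg]
    exact IsOpenImmersion.of_comp g f
  exact (h.restrict g).of_iso ((Scheme.Modules.restrictFunctorComp g f).symm.app M ≪≫
    (Scheme.Modules.restrictFunctorCongr hg).app M)

lemma exists_affine_subset (x : X) (U : X.Opens) (hx : x ∈ U) :
    ∃ (A : CommRingCat.{u}) (j : Spec A ⟶ X) (_ : IsOpenImmersion j),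
      x ∈ Set.range j ∧ Set.range j ⊆ U := by
  obtain ⟨V, hV, hxV, hVU⟩ := Opens.isBasis_iff_nbhd.1 X.isBasis_affineOpens hx
  have hj : Set.range (IsAffineOpen.fromSpec hV) = V := IsAffineOpen.range_fromSpec hV
  exact ⟨_, IsAffineOpen.fromSpec hV, IsAffineOpen.isOpenImmersion_fromSpec hV,
    by rw [hj]; exact hxV, by rw [hj]; exact hVU⟩

lemma exists_common_affine {M N : X.Modules} (hM : IsCoherent M) (hN : IsCoherent N) (x : X) :
    ∃ (A : CommRingCat.{u}) (j : Spec A ⟶ X) (_ : IsOpenImmersion j),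
      x ∈ Set.range j ∧ HasFinPres (M.restrict j) ∧ HasFinPres (N.restrict j) := by
  obtain ⟨A₁, f₁, _, h₁, hM⟩ := (isCoherent_iff M).1 hM x
  obtain ⟨A₂, f₂, _, h₂, hN⟩ := (isCoherent_iff N).1 hN x
  obtain ⟨A, j, hj, hx, hr⟩ := exists_affine_subset x (f₁.opensRange ⊓ f₂.opensRange) ⟨h₁, h₂⟩
  exact ⟨A, j, hj, hx, hM.restrict_of_range j (hr.trans inf_le_left),
    hN.restrict_of_range j (hr.trans inf_le_right)⟩

lemma isNoetherianRing_of_isOpenImmersion [IsLocallyNoetherian X] {A : CommRingCat.{u}}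
    (j : Spec A ⟶ X) [IsOpenImmersion j] : IsNoetherianRing A :=
  isLocallyNoetherian_Spec.1 (isLocallyNoetherian_of_isOpenImmersion j)

variable [IsLocallyNoetherian X]

lemma IsCoherent.kernel {M N : X.Modules} (hM : IsCoherent M) (hN : IsCoherent N) (f : M ⟶ N) :
    IsCoherent (kernel f) := by
  rw [isCoherent_iff]
  intro x
  obtain ⟨A, j, hj, hx, hM, hN⟩ := exists_common_affine hM hN x
  have := isNoetherianRing_of_isOpenImmersion j
  exact ⟨A, j, hj, hx, (hM.kernel hN ((Scheme.Modules.restrictFunctor j).map f)).of_iso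
    (PreservesKernel.iso (Scheme.Modules.restrictFunctor j) f).symm⟩

lemma IsCoherent.cokernel {M N : X.Modules} (hM : IsCoherent M) (hN : IsCoherent N) (f : M ⟶ N) :
    IsCoherent (cokernel f) := by
  rw [isCoherent_iff]
  intro x
  obtain ⟨A, j, hj, hx, hM, hN⟩ := exists_common_affine hM hN x
  have := isNoetherianRing_of_isOpenImmersion j
  exact ⟨A, j, hj, hx, (hM.cokernel hN ((Scheme.Modules.restrictFunctor j).map f)).of_iso
    (PreservesCokernel.iso (Scheme.Modules.restrictFunctor j) f).symm⟩

/-- The middle term of a short exact sequence is a quotient of the sum of the left term and any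
object which lifts an epimorphism to the right term. -/
lemma exact_of_lift {C : Type*} [Category* C] [Abelian C] (S : ShortComplex C)
    (hS : S.ShortExact) {E : C} (p : E ⟶ S.X₃) (hp : Epi p) (e : E ⟶ S.X₂) (he : e ≫ S.g = p) :
    ∃ (k : kernel p ⟶ S.X₁ ⊞ E), Nonempty (S.X₂ ≅ cokernel k) := by
  have := hS.mono_f
  let l : kernel p ⟶ S.X₁ := hS.exact.lift (kernel.ι p ≫ e) (by simp [he])
  have hl : l ≫ S.f = kernel.ι p ≫ e := hS.exact.lift_f _ _
  let k : kernel p ⟶ S.X₁ ⊞ E := biprod.lift l (-kernel.ι p)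
  let q : S.X₁ ⊞ E ⟶ S.X₂ := biprod.desc S.f e
  have hkq : k ≫ q = 0 := by simp [k, q, hl]
  have hq : Epi q := by
    refine Preadditive.epi_of_cancel_zero _ fun {Z} z hz => ?_
    have h1 : S.f ≫ z = 0 := by simpa [q] using biprod.inl ≫= hz
    have h2 : e ≫ z = 0 := by simpa [q] using biprod.inr ≫= hz
    have := hS.epi_g
    have hz : S.g ≫ hS.exact.desc z h1 = z := hS.exact.g_desc _ _
    rw [← hz, ← Category.assoc, he] at h2
    rw [← hz, zero_of_epi_comp p h2, comp_zero]
  have hex : (ShortComplex.mk k q hkq).Exact := by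
    rw [ShortComplex.exact_iff_exact_up_to_refinements]
    intro T t ht
    have h1 : t ≫ biprod.snd ≫ p = 0 := by
      have := ht =≫ S.g
      have hqg : q ≫ S.g = biprod.snd ≫ p := by
        ext <;> simp [q, he]
      simpa [hqg] using this
    have ht' : (t ≫ biprod.fst) ≫ S.f + (t ≫ biprod.snd) ≫ e = 0 := by
      have hq' : q = biprod.fst ≫ S.f + biprod.snd ≫ e := by ext <;> simp [q]
      simpa [hq'] using ht
    refine ⟨T, 𝟙 T, inferInstance, kernel.lift p (-(t ≫ biprod.snd)) (by simp [h1]), ?_⟩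
    ext
    · rw [← cancel_mono S.f]
      simp [k, hl]
      simpa [eq_neg_iff_add_eq_zero] using ht'
    · simp [k]
  exact ⟨k, ⟨hex.gIsCokernel.coconePointUniqueUpToIso (colimit.isColimit _)⟩⟩

/-- The middle term is not known to be quasi-coherent, so the sequence cannot be replaced by one of
modules at once. Locally the right term is a quotient of a finite free sheaf, whose map lifts to the
middle term after shrinking; `exact_of_lift` then writes the middle term as a cokernel of finitely
presented sheaves. -/
lemma IsCoherent.of_shortExact {S : ShortComplex X.Modules} (hS : S.ShortExact)
    (h₁ : IsCoherent S.X₁) (h₃ : IsCoherent S.X₃) : IsCoherent S.X₂ := by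
  rw [isCoherent_iff]
  intro x
  obtain ⟨A, i, hi, ⟨y, rfl⟩, h₁, h₃⟩ := exists_common_affine h₁ h₃ x
  have := isNoetherianRing_of_isOpenImmersion i
  have hT := hS.map_of_exact (Scheme.Modules.restrictFunctor i)
  generalize hTS : S.map (Scheme.Modules.restrictFunctor i) = T at hT
  have h₁ : HasFinPres T.X₁ := by subst hTS; exact h₁
  have h₃ : HasFinPres T.X₃ := by subst hTS; exact h₃
  have h₂ : S.X₂.restrict i = T.X₂ := by subst hTS; rfl
  obtain ⟨N, hN, ⟨e⟩⟩ := h₃.exists_tilde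
  obtain ⟨n, q, hq⟩ := Module.Finite.exists_fin' A N
  let q' : ModuleCat.of A (Fin n → A) ⟶ N := ModuleCat.ofHom q
  have : Epi q' := (ModuleCat.epi_iff_surjective _).2 hq
  let p := (tilde.functor A).map q' ≫ e.inv
  have := hT.epi_g
  obtain ⟨U, hyU, hU⟩ := exists_lift_of_epi T.g n p y
  obtain ⟨B, j, hj, hyj, hjU⟩ := exists_affine_subset y U hyU
  have := isNoetherianRing_of_isOpenImmersion j
  obtain ⟨l, hl⟩ := hU j hjU
  have hp₀ : Epi p := epi_comp _ _
  have hp : Epi ((Scheme.Modules.restrictFunctor j).map p) := inferInstance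
  obtain ⟨k, ⟨c⟩⟩ := exact_of_lift _ (hT.map_of_exact (Scheme.Modules.restrictFunctor j)) _ hp l hl
  have hF : HasFinPres (Scheme.Modules.restrict
    ((tilde.functor A).obj (ModuleCat.of A (Fin n → A))) j) := (hasFinPres_tilde _).restrict j
  have h := (hF.kernel (h₃.restrict j) ((Scheme.Modules.restrictFunctor j).map p)).cokernel
    ((h₁.restrict j).biprod hF) k
  obtain ⟨z, rfl⟩ := hyj
  refine ⟨B, j ≫ i, inferInstance, ⟨z, by rw [Scheme.Hom.comp_apply]⟩, ?_⟩
  have h := h.of_iso c.symm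
  subst hTS
  exact h.of_iso ((Scheme.Modules.restrictFunctorComp j i).app S.X₂).symm

/-- Coherence of the middle term of a five term exact sequence. -/
lemma IsCoherent.of_exact {M₁ M₂ M₃ M₄ M₅ : X.Modules}
    (f₁ : M₁ ⟶ M₂) (f₂ : M₂ ⟶ M₃) (f₃ : M₃ ⟶ M₄) (f₄ : M₄ ⟶ M₅) (w₁ : f₁ ≫ f₂ = 0)
    (w₂ : f₂ ≫ f₃ = 0) (w₃ : f₃ ≫ f₄ = 0) (e₁ : (ShortComplex.mk f₁ f₂ w₁).Exact)
    (e₂ : (ShortComplex.mk f₂ f₃ w₂).Exact) (e₃ : (ShortComplex.mk f₃ f₄ w₃).Exact)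
    (h₁ : IsCoherent M₁) (h₂ : IsCoherent M₂) (h₄ : IsCoherent M₄) (h₅ : IsCoherent M₅) :
    IsCoherent M₃ := by
  let a : Limits.cokernel f₁ ⟶ M₃ := cokernel.desc f₁ f₂ w₁
  let b : M₃ ⟶ Limits.kernel f₄ := kernel.lift f₄ f₃ w₃
  have ha : Mono a := e₁.mono_cokernelDesc
  have hb : Epi b := e₃.epi_kernelLift
  have w : a ≫ b = 0 := by
    rw [← cancel_epi (cokernel.π f₁), ← cancel_mono (kernel.ι f₄)]
    simp [a, b, w₂]
  have h : (ShortComplex.mk a b w).ShortExact := by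
    refine ShortComplex.ShortExact.mk' ?_ ha hb
    rw [ShortComplex.exact_iff_exact_up_to_refinements] at e₂ ⊢
    intro T t ht
    obtain ⟨T', π, hπ, s, hs⟩ := e₂ t (by simpa [b] using ht =≫ kernel.ι f₄)
    exact ⟨T', π, hπ, s ≫ cokernel.π f₁, by simpa [a] using hs⟩
  exact IsCoherent.of_shortExact h (h₁.cokernel h₂ f₁) (h₄.kernel h₅ f₄)

end Coherent

/-! ### Subschemes obtained by base change along a quotient of rings -/

section Algebra

/-- Exactness of multiplication by two scalars is inherited by flat modules. -/
lemma exists_smul_eq_of_flat {A O M : Type*} [CommRing A] [CommRing O] [AddCommGroup M]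
    [Module O M] (ψ : A →+* O) (hψ : ψ.Flat) [Module.Flat O M] (b c : A)
    (h : ∀ x : A, c * x = 0 → ∃ y, x = b * y) (hbc : c * b = 0) (m : M) (hm : ψ c • m = 0) :
    ∃ m' : M, m = ψ b • m' := by
  algebraize [ψ]
  let _ : Module A M := Module.compHom M ψ
  have : IsScalarTower A O M := ⟨fun x y z => by
    rw [Algebra.smul_def, mul_smul]
    rfl⟩
  have : Module.Flat A M := Module.Flat.trans A O M
  have hex : Function.Exact (LinearMap.mulLeft A b) (LinearMap.mulLeft A c) := fun x =>
    ⟨fun hx => by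
      obtain ⟨y, rfl⟩ := h x hx
      exact ⟨y, rfl⟩, fun ⟨y, hy⟩ => by
      rw [← hy]
      simp [← mul_assoc, hbc]⟩
  have hM := Module.Flat.lTensor_exact M hex
  have key : ∀ (d : A) (t : TensorProduct A M A), TensorProduct.rid A M
      (LinearMap.lTensor M (LinearMap.mulLeft A d) t) = d • TensorProduct.rid A M t := by
    intro d t
    induction t with
    | zero => simp
    | add x y hx hy => simp [hx, hy]
    | tmul x y => simp [mul_smul]
  have h0 : LinearMap.lTensor M (LinearMap.mulLeft A c) ((TensorProduct.rid A M).symm m) = 0 := by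
    apply (TensorProduct.rid A M).injective
    rw [key, LinearEquiv.apply_symm_apply, map_zero]
    exact hm
  obtain ⟨t, ht⟩ := (hM _).1 h0
  refine ⟨TensorProduct.rid A M t, ?_⟩
  have := key b t
  rw [ht, LinearEquiv.apply_symm_apply] at this
  exact this

/-- The quotient of `S` by `f a` receives compatible maps from `S` and `B`, hence a map from the
pushout. Whatever dies in `P` dies in that quotient. -/
lemma ker_of_isPushout {A S B P : CommRingCat.{u}} {f : A ⟶ S} {g : A ⟶ B} {i : S ⟶ P}
    {j : B ⟶ P} (h : IsPushout f g i j) (hg : Function.Surjective g.hom) (a : A)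
    (ha : RingHom.ker g.hom = Ideal.span {a}) (s : S) (hs : i s = 0) :
    s ∈ Ideal.span {f a} := by
  let Q : CommRingCat.{u} := .of (S ⧸ Ideal.span {f a})
  let q : S ⟶ Q := CommRingCat.ofHom (Ideal.Quotient.mk _)
  have hq : RingHom.ker g.hom ≤ RingHom.ker (f ≫ q).hom := by
    rw [ha, Ideal.span_singleton_le_iff_mem, RingHom.mem_ker]
    exact Ideal.Quotient.eq_zero_iff_mem.2 (Ideal.mem_span_singleton_self _)
  let l : B ⟶ Q := CommRingCat.ofHom (RingHom.liftOfSurjective g.hom hg ⟨(f ≫ q).hom, hq⟩)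
  have hl : f ≫ q = g ≫ l := by
    ext x
    exact (RingHom.liftOfSurjective_comp_apply g.hom hg ⟨(f ≫ q).hom, hq⟩ x).symm
  have : q s = 0 := by
    rw [← h.inl_desc q l hl, ConcreteCategory.comp_apply, hs, map_zero]
  exact Ideal.Quotient.eq_zero_iff_mem.1 this

end Algebra

section StructureSection

open TopologicalSpace

variable {X Z : Scheme.{u}} {A B : CommRingCat.{u}}

/-- The homomorphism `A → Γ(X, ⊤)` given by a morphism from `X` to `Spec A`. -/
def structureSection (g : X ⟶ Spec A) : A ⟶ Γ(X, ⊤) :=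
  (Scheme.ΓSpecIso A).inv ≫ g.appTop

lemma flat_germ_structureSection (g : X ⟶ Spec A) [Flat g] (x : X) :
    (structureSection g ≫ X.presheaf.germ ⊤ x trivial).hom.Flat := by
  obtain ⟨U, hU, hx, -⟩ := Opens.isBasis_iff_nbhd.1 X.isBasis_affineOpens (Opens.mem_top x)
  have h : structureSection g ≫ X.presheaf.germ ⊤ x trivial =
      (Scheme.ΓSpecIso A).inv ≫ g.appLE ⊤ U le_top ≫ X.presheaf.germ U x hx := by
    rw [structureSection, Category.assoc]
    congr 1
    refine Eq.trans ?_ (Category.assoc _ _ _)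
    exact congrArg (g.appTop ≫ ·) (TopCat.Presheaf.germ_res X.presheaf (homOfLE le_top) x hx).symm
  rw [h, CommRingCat.hom_comp, CommRingCat.hom_comp]
  have h1 : (X.presheaf.germ U x hx).hom.Flat := by
    let := X.presheaf.algebra_section_stalk (⟨x, hx⟩ : U)
    have := hU.isLocalization_stalk ⟨x, hx⟩
    exact IsLocalization.flat (R := Γ(X, U)) (X.presheaf.stalk x)
      (hU.primeIdealOf ⟨x, hx⟩).asIdeal.primeCompl
  refine RingHom.Flat.comp (RingHom.Flat.of_bijective ?_) (RingHom.Flat.comp ?_ h1)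
  · exact (Scheme.ΓSpecIso A).symm.commRingCatIsoToRingEquiv.bijective
  · exact Flat.flat_appLE g (isAffineOpen_top _) hU _

lemma isUnit_germ_structureSection (g : X ⟶ Spec A) (x : X) (a : A)
    (h : a ∉ (g x).asIdeal) : IsUnit (X.presheaf.germ ⊤ x trivial (structureSection g a)) := by
  rw [← Scheme.mem_basicOpen_top]
  have : X.basicOpen (structureSection g a) =
      g ⁻¹ᵁ (Spec A).basicOpen ((Scheme.ΓSpecIso A).inv a) := by
    rw [Scheme.preimage_basicOpen_top]
    rfl
  rw [this, basicOpen_eq_of_affine]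
  exact h

lemma structureSection_comp (f : Z ⟶ X) (g : X ⟶ Spec A) :
    structureSection (f ≫ g) = structureSection g ≫ f.appTop := by
  simp [structureSection]

lemma structureSection_specMap (g : X ⟶ Spec B) (φ : A ⟶ B) :
    structureSection (g ≫ Spec.map φ) = φ ≫ structureSection g := by
  rw [structureSection_comp, structureSection, structureSection,
    Scheme.ΓSpecIso_inv_naturality_assoc]
  rfl

/-- On affine opens the fibre product is a pushout of rings, so `ker_of_isPushout` computes the
kernel on sections. For the stalks, a germ that dies on `Z` dies on a neighbourhood, which is shrunk
until it contains the preimage of an affine open of `X`. -/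
lemma isCutOutBy_of_isPullback {f : Z ⟶ X} {g' : Z ⟶ Spec B} {g : X ⟶ Spec A} {φ : A ⟶ B}
    (h : IsPullback f g' g (Spec.map φ)) (hφ : Function.Surjective φ.hom) (a : A)
    (ha : RingHom.ker φ.hom = Ideal.span {a}) : IsCutOutBy f (structureSection g a) := by
  have hcl : IsClosedImmersion (Spec.map φ) := IsClosedImmersion.spec_of_surjective φ hφ
  have hf : IsClosedImmersion f := MorphismProperty.of_isPullback h.flip hcl
  have hφa : φ a = 0 := by
    have : a ∈ RingHom.ker φ.hom := ha ▸ Ideal.mem_span_singleton_self a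
    exact this
  refine ⟨hf, fun x hx => ?_, fun z => le_antisymm ?_ ?_⟩
  · refine isUnit_germ_structureSection g x a fun hax => hx ?_
    have hgx : g x ∈ Set.range (Spec.map φ) := by
      have : Set.range (Spec.map φ) = PrimeSpectrum.zeroLocus (RingHom.ker φ.hom : Set A) :=
        range_comap_of_surjective _ φ.hom hφ
      rw [this, ha, PrimeSpectrum.zeroLocus_span]
      exact Set.singleton_subset_iff.2 hax
    have hr : x ∈ Set.range (pullback.fst g (Spec.map φ)) := by
      rw [Scheme.Pullback.range_fst]
      exact hgx
    obtain ⟨w, hw⟩ := hr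
    refine ⟨h.isoPullback.inv w, ?_⟩
    rw [← Scheme.Hom.comp_apply, h.isoPullback_inv_fst, hw]
  · intro t ht
    obtain ⟨U, hU, t, rfl⟩ := TopCat.Presheaf.exists_germ_eq X.presheaf t
    have ht : Z.presheaf.germ (f ⁻¹ᵁ U) z hU (f.app U t) = Z.presheaf.germ (f ⁻¹ᵁ U) z hU 0 := by
      rw [← Scheme.Hom.germ_stalkMap_apply, map_zero]
      exact ht
    obtain ⟨W, hW, iU, iU', hWt⟩ := TopCat.Presheaf.germ_eq Z.presheaf z hU hU _ _ ht
    obtain ⟨V₁, hV₁, hVW⟩ := f.isEmbedding.isInducing.isOpen_iff.1 W.2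
    obtain ⟨V, hV, hzV, hVU⟩ := Opens.isBasis_iff_nbhd.1 X.isBasis_affineOpens
      (show f z ∈ U ⊓ ⟨V₁, hV₁⟩ from ⟨hU, by
        have : z ∈ f ⁻¹' V₁ := by rw [hVW]; exact hW
        exact this⟩)
    have hVW' : f ⁻¹ᵁ V ≤ W := fun y hy => by
      have : y ∈ f ⁻¹' V₁ := (hVU hy).2
      rw [hVW] at this
      exact this
    let t₁ := X.presheaf.map (homOfLE (hVU.trans inf_le_left)).op t
    have hiso := isIso_pushoutSection_of_isAffineOpen h (US := ⊤) (UT := ⊤) (UX := V)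
      (UY := f ⁻¹ᵁ V ⊓ g' ⁻¹ᵁ ⊤) le_top le_top rfl (isAffineOpen_top _) (isAffineOpen_top _) hV
    have hpo := (isIso_pushoutSection_iff h le_top le_top rfl).1 hiso
    have hφ' : (Spec.map φ).appLE ⊤ ⊤ le_top =
        (Scheme.ΓSpecIso A).hom ≫ φ ≫ (Scheme.ΓSpecIso B).inv := by
      have e := Scheme.ΓSpecIso_naturality φ
      rw [← Iso.eq_comp_inv, Category.assoc] at e
      exact (Scheme.Hom.appLE_eq_app (Spec.map φ) (U := ⊤)).trans e
    have h1 : (f.appLE V (f ⁻¹ᵁ V ⊓ g' ⁻¹ᵁ ⊤) inf_le_left) t₁ = 0 := by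
      have e : X.presheaf.map (homOfLE (hVU.trans inf_le_left)).op ≫
          f.appLE V (f ⁻¹ᵁ V ⊓ g' ⁻¹ᵁ ⊤) inf_le_left =
          f.app U ≫ Z.presheaf.map iU.op ≫ Z.presheaf.map
            (homOfLE (inf_le_left.trans hVW' : f ⁻¹ᵁ V ⊓ g' ⁻¹ᵁ ⊤ ≤ W)).op := by
        rw [Scheme.Hom.map_appLE, ← Functor.map_comp]
        rfl
      have e' := congr($e t)
      rw [ConcreteCategory.comp_apply, ConcreteCategory.comp_apply, ConcreteCategory.comp_apply,
        hWt, map_zero, map_zero] at e'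
      exact e'
    have key := ker_of_isPushout hpo ?_ ((Scheme.ΓSpecIso A).inv a) ?_ t₁ h1
    · obtain ⟨c, hc⟩ := Ideal.mem_span_singleton'.1 key
      rw [Ideal.mem_span_singleton']
      refine ⟨X.presheaf.germ V (f z) hzV c, ?_⟩
      have e1 : X.presheaf.germ ⊤ (f z) trivial (structureSection g a) =
          X.presheaf.germ V (f z) hzV (g.appLE ⊤ V le_top ((Scheme.ΓSpecIso A).inv a)) :=
        (TopCat.Presheaf.germ_res_apply X.presheaf (homOfLE le_top) (f z) hzV
          (structureSection g a)).symm
      rw [e1, ← map_mul, hc]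
      exact TopCat.Presheaf.germ_res_apply X.presheaf _ (f z) hzV t
    · rw [hφ']
      exact ((Scheme.ΓSpecIso B).symm.commRingCatIsoToRingEquiv.surjective.comp hφ).comp
        (Scheme.ΓSpecIso A).commRingCatIsoToRingEquiv.surjective
    · rw [hφ']
      have e1 := (Scheme.ΓSpecIso A).inv_hom_id
      have e2 := (Scheme.ΓSpecIso A).hom_inv_id
      refine le_antisymm (fun t ht => ?_) ?_
      · have h0 : (Scheme.ΓSpecIso A).hom t ∈ RingHom.ker φ.hom := by
          refine (Scheme.ΓSpecIso B).symm.commRingCatIsoToRingEquiv.injective ?_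
          exact ht.trans (map_zero _).symm
        rw [ha] at h0
        obtain ⟨c, hc⟩ := Ideal.mem_span_singleton'.1 h0
        refine Ideal.mem_span_singleton'.2 ⟨(Scheme.ΓSpecIso A).inv c, ?_⟩
        rw [← map_mul, hc]
        exact congr($e2 t)
      · rw [Ideal.span_singleton_le_iff_mem, RingHom.mem_ker]
        have h0 : (Scheme.ΓSpecIso A).hom ((Scheme.ΓSpecIso A).inv a) = a := congr($e1 a)
        rw [CommRingCat.hom_comp, CommRingCat.hom_comp, RingHom.comp_apply, RingHom.comp_apply]
        refine (congrArg (fun t => (Scheme.ΓSpecIso B).inv.hom (φ.hom t)) h0).trans ?_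
        exact (congrArg (Scheme.ΓSpecIso B).inv.hom hφa).trans (map_zero _)
  · rw [Ideal.span_singleton_le_iff_mem, RingHom.mem_ker]
    have h0 : f.appTop (structureSection g a) = 0 := by
      rw [← ConcreteCategory.comp_apply, ← structureSection_comp, h.w, structureSection_specMap,
        ConcreteCategory.comp_apply, hφa, map_zero]
    refine (Scheme.Hom.germ_stalkMap_apply f ⊤ z trivial _).trans ?_
    exact (congrArg _ h0).trans (map_zero _)

end StructureSection

section BaseChange

variable {k : Type u} [Field k] {X : Scheme.{u}} (s : X ⟶ Spec (.of k))

/-- The structure morphism `X ⊗_k A ⟶ Spec A`. -/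
def toSpec (A : Type u) [CommRing A] [Algebra k A] : baseChange s A ⟶ Spec (.of A) :=
  pullback.snd _ _

instance flat_toSpec [Flat s] (A : Type u) [CommRing A] [Algebra k A] : Flat (toSpec s A) := by
  exact inferInstanceAs (Flat (pullback.snd s (Spec.map (CommRingCat.ofHom (algebraMap k A)))))

lemma isLocallyNoetherian_baseChange [LocallyOfFiniteType s] (A : Type u) [CommRing A]
    [Algebra k A] [IsNoetherianRing A] : IsLocallyNoetherian (baseChange s A) := by
  have : LocallyOfFiniteType (toSpec s A) := inferInstanceAs
    (LocallyOfFiniteType (pullback.snd s (Spec.map (CommRingCat.ofHom (algebraMap k A)))))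
  have : IsLocallyNoetherian (Spec (.of A)) := isLocallyNoetherian_Spec.2 ‹_›
  exact LocallyOfFiniteType.isLocallyNoetherian (toSpec s A)

variable {A B C : Type u} [CommRing A] [Algebra k A] [CommRing B] [Algebra k B] [CommRing C]
  [Algebra k C] (φ : A →ₐ[k] B)

lemma baseChangeMap_fst :
    baseChangeMap s φ ≫ pullback.fst s (Spec.map (CommRingCat.ofHom (algebraMap k A))) =
      pullback.fst s (Spec.map (CommRingCat.ofHom (algebraMap k B))) :=
  (pullback.lift_fst _ _ _).trans (Category.comp_id _)

lemma baseChangeMap_toSpec : baseChangeMap s φ ≫ toSpec s A =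
    toSpec s B ≫ Spec.map (CommRingCat.ofHom φ.toRingHom) :=
  pullback.lift_snd _ _ _

lemma isPullback_baseChangeMap :
    IsPullback (baseChangeMap s φ) (toSpec s B) (toSpec s A)
      (Spec.map (CommRingCat.ofHom φ.toRingHom)) := by
  have h2 : IsPullback (pullback.fst s (Spec.map (CommRingCat.ofHom (algebraMap k A))))
      (toSpec s A) s (Spec.map (CommRingCat.ofHom (algebraMap k A))) :=
    IsPullback.of_hasPullback _ _
  refine IsPullback.of_right ?_ ?_ h2
  · have h1 : IsPullback (pullback.fst s (Spec.map (CommRingCat.ofHom (algebraMap k B))))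
      (toSpec s B) s (Spec.map (CommRingCat.ofHom (algebraMap k B))) :=
    IsPullback.of_hasPullback _ _
    have e2 : Spec.map (CommRingCat.ofHom φ.toRingHom) ≫
        Spec.map (CommRingCat.ofHom (algebraMap k A)) =
        Spec.map (CommRingCat.ofHom (algebraMap k B)) := by
      rw [← Spec.map_comp, ← CommRingCat.ofHom_comp]
      congr 2
      exact φ.comp_algebraMap
    rw [baseChangeMap_fst, e2]
    exact h1
  · exact baseChangeMap_toSpec s φ

lemma isCutOutBy_baseChangeMap (hφ : Function.Surjective φ) (a : A)
    (ha : RingHom.ker φ.toRingHom = Ideal.span {a}) :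
    IsCutOutBy (baseChangeMap s φ) (structureSection (toSpec s A) a) :=
  isCutOutBy_of_isPullback (isPullback_baseChangeMap s φ) hφ a ha

lemma baseChangeMap_comp (ψ : B →ₐ[k] C) :
    baseChangeMap s ψ ≫ baseChangeMap s φ = baseChangeMap s (ψ.comp φ) := by
  refine pullback.hom_ext ?_ ?_
  · exact (Category.assoc _ _ _).trans ((congrArg _ (baseChangeMap_fst s φ)).trans
      ((baseChangeMap_fst s ψ).trans (baseChangeMap_fst s _).symm))
  · refine (Category.assoc _ _ _).trans ((congrArg _ (baseChangeMap_toSpec s φ)).trans ?_)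
    refine (Category.assoc _ _ _).symm.trans
      ((congrArg (· ≫ _) (baseChangeMap_toSpec s ψ)).trans ?_)
    refine Eq.trans ?_ (baseChangeMap_toSpec s _).symm
    rw [Category.assoc, ← Spec.map_comp, ← CommRingCat.ofHom_comp]
    rfl

end BaseChange

/-! ### The filtration by powers of an endomorphism -/

section Filtration

variable {C : Type*} [Category* C] [Abelian C]

/-- If `p` is an endomorphism with `p ^ m = 0` and `(p ^ (m - j), p ^ j)` is exact for `0 < j < m`,
then the object is an iterated extension of copies of the cokernel of `p`. -/
lemma of_cokernel_of_exact_powers {K : C} (p : ℕ → (K ⟶ K))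
    (hp : ∀ i j, p (i + j) = p i ≫ p j) {m : ℕ} (hm : 1 ≤ m) (h0 : p m = 0)
    (hex : ∀ i j, 0 < i → 0 < j → ∀ hij : i + j = m,
      (ShortComplex.mk (p i) (p j) (by rw [← hp, hij]; exact h0)).Exact)
    (T : C → Prop) (hT : ∀ S : ShortComplex C, S.ShortExact → T S.X₁ → T S.X₃ → T S.X₂)
    (hiso : ∀ {M N : C}, (M ≅ N) → T M → T N) (h1 : T (cokernel (p 1))) : T K := by
  -- The sequence `coker (p 1) → coker (p (j + 1)) → coker (p j)`, with first map induced by `p j`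
  -- and second the projection, is short exact.
  have step : ∀ j, 0 < j → j < m → T (cokernel (p j)) → T (cokernel (p (j + 1))) := by
    intro j hj hjm hTj
    have e : p (j + 1) = p 1 ≫ p j := by rw [add_comm, hp]
    let α : cokernel (p 1) ⟶ cokernel (p (j + 1)) := cokernel.desc _ (p j ≫ cokernel.π _) (by
      rw [← Category.assoc, ← e, cokernel.condition])
    let β : cokernel (p (j + 1)) ⟶ cokernel (p j) := cokernel.desc _ (cokernel.π _) (by
      rw [e, Category.assoc, cokernel.condition, comp_zero])
    have w : α ≫ β = 0 := by
      rw [← cancel_epi (cokernel.π (p 1))]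
      simp [α, β]
    have hα : cokernel.π (p 1) ≫ α = p j ≫ cokernel.π _ := cokernel.π_desc _ _ _
    have hβ : cokernel.π (p (j + 1)) ≫ β = cokernel.π _ := cokernel.π_desc _ _ _
    have hβe : Epi β := by
      have : Epi (cokernel.π (p (j + 1)) ≫ β) := by rw [hβ]; infer_instance
      exact epi_of_epi (cokernel.π (p (j + 1))) β
    have hcok : ∀ i, (ShortComplex.mk (p i) (cokernel.π (p i)) (cokernel.condition _)).Exact :=
      fun i => ShortComplex.exact_of_g_is_cokernel _ (cokernelIsCokernel (p i))
    -- Exactness of the powers enters here. If `p j` sends `t'` into the image of `p (j + 1)`, then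
    -- `t'` differs from an element of the image of `p 1` by one killed by `p j`. The latter lies in
    -- the image of `p (m - j)`, hence of `p 1` since `j < m`.
    have hmono : Mono α := by
      refine Preadditive.mono_of_cancel_zero _ fun {Z} t ht => ?_
      obtain ⟨Z₁, π₁, _, t', ht'⟩ :=
        surjective_up_to_refinements_of_epi (cokernel.π (p 1)) t
      have h2 : (t' ≫ p j) ≫ cokernel.π (p (j + 1)) = 0 := by
        rw [Category.assoc, ← hα, ← Category.assoc, ← ht', Category.assoc, ht, comp_zero]
      obtain ⟨Z₂, π₂, _, u, hu⟩ := (hcok (j + 1)).exact_up_to_refinements (t' ≫ p j) h2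
      dsimp only at u hu
      have h3 : (π₂ ≫ t' - u ≫ p 1) ≫ p j = 0 := by
        rw [Preadditive.sub_comp, Category.assoc, hu, e, Category.assoc, sub_self]
      obtain ⟨Z₃, π₃, _, v, hv⟩ := (hex (m - j) j (by lia) hj (by lia)).exact_up_to_refinements _ h3
      dsimp only at v hv
      have e' : p (m - j) = p (m - j - 1) ≫ p 1 := by
        rw [← hp]
        congr 1
        lia
      rw [← cancel_epi π₁, ← cancel_epi π₂, ← cancel_epi π₃, comp_zero, comp_zero, comp_zero, ht']
      have h4 := hv =≫ cokernel.π (p 1)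
      rw [e', Preadditive.comp_sub, Preadditive.sub_comp] at h4
      simpa using h4
    have hexact : (ShortComplex.mk α β w).Exact := by
      rw [ShortComplex.exact_iff_exact_up_to_refinements]
      intro Z t ht
      dsimp only at t ht
      obtain ⟨Z₁, π₁, _, t', ht'⟩ :=
        surjective_up_to_refinements_of_epi (cokernel.π (p (j + 1))) t
      have h2 : t' ≫ cokernel.π (p j) = 0 := by
        rw [← hβ, ← Category.assoc, ← ht', Category.assoc, ht, comp_zero]
      obtain ⟨Z₂, π₂, _, u, hu⟩ := (hcok j).exact_up_to_refinements t' h2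
      dsimp only at u hu
      refine ⟨Z₂, π₂ ≫ π₁, inferInstance, u ≫ cokernel.π (p 1), ?_⟩
      dsimp only
      rw [Category.assoc, Category.assoc, ht', hα, ← Category.assoc, hu, Category.assoc]
    exact hT _ (ShortComplex.ShortExact.mk' hexact hmono hβe) h1 hTj
  have all : ∀ j, j + 1 ≤ m → T (cokernel (p (j + 1))) := by
    intro j
    induction j with
    | zero => exact fun _ => h1
    | succ j ih => exact fun h => step (j + 1) (by lia) (by lia) (ih (by lia))
  have := all (m - 1) (by lia)
  rw [Nat.sub_add_cancel hm, h0] at this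
  exact hiso cokernelZeroIsoTarget this

end Filtration

/-! ### Supports and their dimension. -/

section Supports

open TopologicalSpace

variable {X : Scheme.{u}}

lemma supp_of_epi {M N : X.Modules} (f : M ⟶ N) [Epi f] : supp N ⊆ supp M := by
  intro x hx
  rw [mem_supp_iff] at hx ⊢
  exact fun h => hx (h.of_epi ((stalkAb x).map f))

lemma supp_of_exact {S : ShortComplex X.Modules} (h : S.Exact) :
    supp S.X₂ ⊆ supp S.X₁ ∪ supp S.X₃ := by
  intro x hx
  by_contra h'
  rw [Set.mem_union, not_or, mem_supp_iff, mem_supp_iff, not_not, not_not] at h'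
  rw [mem_supp_iff] at hx
  exact hx (((exact_iff_stalk S).1 h x).isZero_X₂ (h'.1.eq_of_src _ _) (h'.2.eq_of_tgt _ _))

lemma supp_of_iso {M N : X.Modules} (e : M ≅ N) : supp M = supp N :=
  (supp_of_epi e.inv).antisymm (supp_of_epi e.hom)

lemma krullDim_mono {T : Type*} [TopologicalSpace T] {s t : Set T} (h : s ⊆ t) :
    topologicalKrullDim s ≤ topologicalKrullDim t :=
  (Topology.IsEmbedding.inclusion h).isInducing.topologicalKrullDim_le

lemma krullDim_le_of_image_subset {T T' : Type*} [TopologicalSpace T] [TopologicalSpace T']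
    {f : T → T'} (hf : Topology.IsEmbedding f) {s : Set T} {t : Set T'} (h : f '' s ⊆ t) :
    topologicalKrullDim s ≤ topologicalKrullDim t := by
  have : Topology.IsInducing (Set.MapsTo.restrict f s t (Set.mapsTo_iff_image_subset.2 h)) :=
    (hf.isInducing.comp Topology.IsInducing.subtypeVal).codRestrict _
  exact this.topologicalKrullDim_le

lemma krullDim_image_le {T T' : Type*} [TopologicalSpace T] [TopologicalSpace T']
    {f : T → T'} (hf : Topology.IsEmbedding f) (s : Set T) :
    topologicalKrullDim (f '' s) ≤ topologicalKrullDim s :=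
  (hf.homeomorphImage s).symm.isInducing.topologicalKrullDim_le

variable {Z : Scheme.{u}} {f : Z ⟶ X} {a : Γ(X, ⊤)}

lemma IsCutOutBy.mulHom_unit (hf : IsCutOutBy f a) (M : X.Modules) :
    mulHom a M ≫ (Scheme.Modules.pullbackPushforwardAdjunction f).unit.app M = 0 := by
  refine (mulHom_naturality _ _).trans ?_
  exact (congrArg _ (hf.mulHom_pushforward _)).trans comp_zero

/-- The unit from `F` is an epimorphism, so the image in `X` of the support of the pullback lies in
the support of `F`. -/
lemma CohLE.pullback (hf : IsCutOutBy f a) {d : ℕ} {F : X.Modules} (h : CohLE d F) :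
    CohLE d ((Scheme.Modules.pullback f).obj F) := by
  have := hf.isClosedImmersion
  have := (hf.exact_unit F (hf.mulHom_unit F)).2
  refine ⟨h.1.pullback f, (krullDim_le_of_image_subset f.isEmbedding ?_).trans h.2⟩
  rw [← supp_pushforward]
  exact supp_of_epi ((Scheme.Modules.pullbackPushforwardAdjunction f).unit.app F)

end Supports

/-! ### Multiplication by a function and restriction, on complexes. -/

section Complexes

variable {X Z : Scheme.{u}}

/-- Multiplication by a global function on a complex of sheaves of modules. -/
def mulCpx (a : Γ(X, ⊤)) (K : CochainComplex X.Modules ℤ) : K ⟶ K where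
  f i := mulHom a (K.X i)
  comm' i j _ := mulHom_naturality a (K.d i j)

/-- The unit of the adjunction between pullback and pushforward, on complexes. -/
def unitCpx (f : Z ⟶ X) (K : CochainComplex X.Modules ℤ) :
    K ⟶ ((Scheme.Modules.pushforward f).mapHomologicalComplex (ComplexShape.up ℤ)).obj
      (((Scheme.Modules.pullback f).mapHomologicalComplex (ComplexShape.up ℤ)).obj K) where
  f i := (Scheme.Modules.pullbackPushforwardAdjunction f).unit.app (K.X i)
  comm' i j _ := ((Scheme.Modules.pullbackPushforwardAdjunction f).unit.naturality (K.d i j)).symm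

variable {f : Z ⟶ X} {a : Γ(X, ⊤)} (hf : IsCutOutBy f a)

include hf

lemma IsCutOutBy.mulCpx_unitCpx (K : CochainComplex X.Modules ℤ) :
    mulCpx a K ≫ unitCpx f K = 0 := by
  ext i : 1
  exact hf.mulHom_unit (K.X i)

lemma IsCutOutBy.exact_unitCpx (K : CochainComplex X.Modules ℤ) :
    (ShortComplex.mk (mulCpx a K) (unitCpx f K) (hf.mulCpx_unitCpx K)).Exact ∧
      Epi (unitCpx f K) := by
  refine ⟨HomologicalComplex.exact_of_degreewise_exact _ fun i => ?_, ?_⟩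
  · exact (hf.exact_unit (K.X i) (hf.mulHom_unit (K.X i))).1
  · have : ∀ i, Epi ((unitCpx f K).f i) := fun i =>
      (hf.exact_unit (K.X i) (hf.mulHom_unit (K.X i))).2
    exact HomologicalComplex.epi_of_epi_f _ this

end Complexes

/-! ### Stability of the heart conditions under extension and pushforward. -/

section HeartLike

variable {X Z : Scheme.{u}}

/-- The conditions on the cohomology sheaves of an object of the heart, relative to a set `S`
containing the support in degree `0` and a class `P` of sheaves without nonzero homomorphisms to
the cohomology sheaf in degree `-1`. -/
structure HeartLike (S : Set X) (P : X.Modules → Prop) (K : CochainComplex X.Modules ℤ) : Prop where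
  isZero : ∀ i : ℤ, i ≠ 0 → i ≠ -1 → IsZero (K.homology i)
  supp_le : supp (K.homology 0) ⊆ S
  hom_eq_zero : ∀ F, P F → ∀ g : F ⟶ K.homology (-1), g = 0

lemma HeartLike.of_homologyIso {S : Set X} {P : X.Modules → Prop}
    {K L : CochainComplex X.Modules ℤ} (h : HeartLike S P K)
    (e : ∀ i, K.homology i ≅ L.homology i) : HeartLike S P L where
  isZero i h0 h1 := (h.isZero i h0 h1).of_iso (e i).symm
  supp_le := (supp_of_iso (e 0)).symm.subset.trans h.supp_le
  hom_eq_zero F hF g := by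
    rw [← cancel_mono (e (-1)).inv, zero_comp]
    exact h.hom_eq_zero F hF _

lemma HeartLike.of_iso {S : Set X} {P : X.Modules → Prop}
    {K L : CochainComplex X.Modules ℤ} (e : K ≅ L) (h : HeartLike S P K) : HeartLike S P L :=
  h.of_homologyIso fun i => (HomologicalComplex.homologyFunctor _ _ i).mapIso e

/-- Since `H^{-2}` of the right term vanishes, `H^{-1}` of the left term is the kernel of the map
from `H^{-1}` of the middle to that of the right. A map from `F` to the middle dies on the right, so
it factors through the left, where it is zero. -/
lemma HeartLike.of_shortExact {S : Set X} {P : X.Modules → Prop}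
    (T : ShortComplex (CochainComplex X.Modules ℤ)) (hT : T.ShortExact)
    (h₁ : HeartLike S P T.X₁) (h₃ : HeartLike S P T.X₃) : HeartLike S P T.X₂ where
  isZero i h0 h1 := (hT.homology_exact₂ i).isZero_X₂ ((h₁.isZero i h0 h1).eq_of_src _ _)
    ((h₃.isZero i h0 h1).eq_of_tgt _ _)
  supp_le := (supp_of_exact (hT.homology_exact₂ 0)).trans (Set.union_subset h₁.supp_le h₃.supp_le)
  hom_eq_zero F hF g := by
    have hm : Mono (HomologicalComplex.homologyMap T.f (-1)) :=
      (hT.homology_exact₁ (-2) (-1) (by simp)).mono_g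
        ((h₃.isZero (-2) (by simp) (by simp)).eq_of_src _ _)
    have h2 : g ≫ HomologicalComplex.homologyMap T.g (-1) = 0 := h₃.hom_eq_zero F hF _
    have hl := (hT.homology_exact₂ (-1)).lift_f g h2
    rw [← hl, h₁.hom_eq_zero F hF ((hT.homology_exact₂ (-1)).lift g h2), zero_comp]

/-- Exact functors commute with the formation of cohomology. -/
def homologyMapIso {C D : Type*} [Category* C] [Category* D] [Abelian C] [Abelian D] (G : C ⥤ D)
    [G.Additive] [PreservesFiniteLimits G] [PreservesFiniteColimits G] (K : CochainComplex C ℤ)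
    (i : ℤ) : ((G.mapHomologicalComplex (ComplexShape.up ℤ)).obj K).homology i ≅
      G.obj (K.homology i) :=
  (K.sc i).mapHomologyIso G

instance (f : Z ⟶ X) : (Scheme.Modules.pushforward f).Additive :=
  (Scheme.Modules.pullbackPushforwardAdjunction f).right_adjoint_additive

/-- By adjunction, maps from `F` to a pushforward are maps from the pullback of `F`; this dictates
the new class of test sheaves. -/
lemma HeartLike.pushforward {f : Z ⟶ X} [IsClosedImmersion f] {S : Set Z}
    {P : Z.Modules → Prop} {K : CochainComplex Z.Modules ℤ} (h : HeartLike S P K) :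
    HeartLike (f '' S) (fun F => P ((Scheme.Modules.pullback f).obj F))
      (((Scheme.Modules.pushforward f).mapHomologicalComplex (ComplexShape.up ℤ)).obj K) := by
  have e := homologyMapIso (Scheme.Modules.pushforward f) K
  refine ⟨fun i h0 h1 => ?_, ?_, fun F hF g => ?_⟩
  · exact ((Scheme.Modules.pushforward f).map_isZero (h.isZero i h0 h1)).of_iso (e i)
  · rw [supp_of_iso (e 0), supp_pushforward]
    exact Set.image_mono h.supp_le
  · let adj := Scheme.Modules.pullbackPushforwardAdjunction f
    rw [← cancel_mono (e (-1)).hom, zero_comp]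
    apply (adj.homEquiv _ _).symm.injective
    rw [h.hom_eq_zero _ hF ((adj.homEquiv _ _).symm (g ≫ (e (-1)).hom)), eq_comm]
    exact h.hom_eq_zero _ hF _

lemma mulCpx_mul (a b : Γ(X, ⊤)) (K : CochainComplex X.Modules ℤ) :
    mulCpx (a * b) K = mulCpx a K ≫ mulCpx b K := by
  ext i : 1
  exact mulHom_mul a b (K.X i)

lemma mulCpx_zero (K : CochainComplex X.Modules ℤ) : mulCpx (0 : Γ(X, ⊤)) K = 0 := by
  ext i : 1
  exact mulHom_zero (K.X i)

/-- If the pullback of a complex to an infinitesimally thinner subscheme satisfies the conditions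
of the heart, and the terms of the complex behave like flat modules, then so does the complex. -/
lemma HeartLike.of_pullback {f : Z ⟶ X} {a : Γ(X, ⊤)} (hf : IsCutOutBy f a) {m : ℕ} (hm : 1 ≤ m)
    (ha : a ^ m = 0) (K : CochainComplex X.Modules ℤ)
    (hex : ∀ (n : ℤ) (i j : ℕ), 0 < i → 0 < j → ∀ hij : i + j = m,
      (ShortComplex.mk (mulHom (a ^ i) (K.X n)) (mulHom (a ^ j) (K.X n)) (by
        rw [← mulHom_mul, ← pow_add, hij, ha, mulHom_zero])).Exact)
    {S : Set Z} {P : Z.Modules → Prop}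
    (h : HeartLike S P
      (((Scheme.Modules.pullback f).mapHomologicalComplex (ComplexShape.up ℤ)).obj K)) :
    HeartLike (f '' S) (fun F => P ((Scheme.Modules.pullback f).obj F)) K := by
  have := hf.isClosedImmersion
  refine of_cokernel_of_exact_powers (fun i => mulCpx (a ^ i) K) ?_ hm ?_ ?_ _
    HeartLike.of_shortExact HeartLike.of_iso ?_
  · intro i j
    rw [pow_add, mulCpx_mul]
  · rw [ha, mulCpx_zero]
  · intro i j hi hj hij
    exact HomologicalComplex.exact_of_degreewise_exact _ fun n => hex n i j hi hj hij
  · dsimp only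
    rw [pow_one]
    -- The cokernel of multiplication by `a` on `K` is the pushforward of the pullback of `K`.
    obtain ⟨h1, h2⟩ := hf.exact_unitCpx K
    exact h.pushforward.of_iso (h1.gIsCokernel.coconePointUniqueUpToIso (colimit.isColimit _))

end HeartLike

/-! ### Comparison of flat resolutions -/

section Derived

variable {X Z : Scheme.{u}}

/-- The cohomology sheaves of the object of the derived category given by a complex. -/
def homologyQIso (K : CochainComplex X.Modules ℤ) (i : ℤ) :
    H i (DerivedCategory.Q.obj K) ≅ K.homology i :=
  (DerivedCategory.homologyFunctorFactors X.Modules i).app K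

/-- The cohomology sheaves of an object represented by a complex. -/
def homologyIsoOfRepresents {K : CochainComplex X.Modules ℤ} {E : DMod X}
    (e : DerivedCategory.Q.obj K ≅ E) (i : ℤ) : H i E ≅ K.homology i :=
  (DerivedCategory.homologyFunctor X.Modules i).mapIso e.symm ≪≫ homologyQIso K i

lemma mulCpx_naturality (a : Γ(X, ⊤)) {K L : CochainComplex X.Modules ℤ} (g : K ⟶ L) :
    g ≫ mulCpx a L = mulCpx a K ≫ g := by
  ext i : 1
  exact (mulHom_naturality a (g.f i)).symm

/-- Multiplication by a global function commutes with morphisms in the derived category. -/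
lemma Q_map_mulCpx_naturality (a : Γ(X, ⊤)) {K L : CochainComplex X.Modules ℤ}
    (g : DerivedCategory.Q.obj K ⟶ DerivedCategory.Q.obj L) :
    g ≫ DerivedCategory.Q.map (mulCpx a L) = DerivedCategory.Q.map (mulCpx a K) ≫ g := by
  let W := HomologicalComplex.quasiIso X.Modules (ComplexShape.up ℤ)
  let Q : CochainComplex X.Modules ℤ ⥤ DMod X := DerivedCategory.Q
  -- Multiplication by `a` is natural in the complex, so it descends to an endomorphism of the
  -- identity functor of the localisation.
  let τ : Q ⟶ Q :=
    { app K := Q.map (mulCpx a K)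
      naturality K L g := by rw [← Q.map_comp, ← Q.map_comp, mulCpx_naturality] }
  let σ := Localization.liftNatTrans Q W Q Q (𝟭 _) (𝟭 _) τ
  have hσ : ∀ K, σ.app (Q.obj K) = Q.map (mulCpx a K) := fun K => by
    refine (Localization.liftNatTrans_app Q W Q Q (𝟭 _) (𝟭 _) τ K).trans ?_
    simp [τ, Localization.Lifting.iso]
  have := σ.naturality g
  rw [hσ, hσ] at this
  exact this

variable {f : Z ⟶ X} {a : Γ(X, ⊤)} (hf : IsCutOutBy f a)

include hf

lemma IsCutOutBy.shortExact_unitCpx (K : CochainComplex X.Modules ℤ)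
    (hK : ∀ i, Mono (mulHom a (K.X i))) :
    (ShortComplex.mk (mulCpx a K) (unitCpx f K) (hf.mulCpx_unitCpx K)).ShortExact := by
  obtain ⟨h1, h2⟩ := hf.exact_unitCpx K
  have : ∀ i, Mono ((mulCpx a K).f i) := hK
  exact ShortComplex.ShortExact.mk' h1 (HomologicalComplex.mono_of_mono_f _ this) h2

/-- The cohomology of the restriction of a complex without torsion only depends on the object
it defines in the derived category. -/
lemma IsCutOutBy.homology_pullback_iso {K L : CochainComplex X.Modules ℤ}
    (hK : ∀ i, Mono (mulHom a (K.X i))) (hL : ∀ i, Mono (mulHom a (L.X i)))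
    (e : DerivedCategory.Q.obj K ≅ DerivedCategory.Q.obj L) (i : ℤ) :
    Nonempty ((((Scheme.Modules.pullback f).mapHomologicalComplex (ComplexShape.up ℤ)).obj
      K).homology i ≅ (((Scheme.Modules.pullback f).mapHomologicalComplex
        (ComplexShape.up ℤ)).obj L).homology i) := by
  have := hf.isClosedImmersion
  have hK' := hf.shortExact_unitCpx K hK
  have hL' := hf.shortExact_unitCpx L hL
  -- Both pushforwards are third vertices of triangles on multiplication by `a`, with which `e`
  -- commutes. The isomorphism on cohomology is then brought back to `Z` because pushforward is
  -- exact and fully faithful.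
  let t := Pretriangulated.isoTriangleOfIso₁₂ _ _ (DerivedCategory.triangleOfSES_distinguished hK')
    (DerivedCategory.triangleOfSES_distinguished hL') e e (Q_map_mulCpx_naturality a e.hom).symm
  let e₃ := Pretriangulated.Triangle.π₃.mapIso t
  let e₄ := (homologyQIso _ i).symm ≪≫
    (DerivedCategory.homologyFunctor X.Modules i).mapIso e₃ ≪≫ homologyQIso _ i
  let e₅ := (homologyMapIso (Scheme.Modules.pushforward f) _ i).symm ≪≫ e₄ ≪≫
    homologyMapIso (Scheme.Modules.pushforward f) _ i
  exact ⟨(Scheme.Modules.pushforward f).preimageIso e₅⟩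

/-- The restriction of an object with coherent cohomology to a subscheme cut out by a single
regular equation has coherent cohomology. -/
lemma IsCutOutBy.isCoherent_homology_pullback [IsLocallyNoetherian X]
    {K : CochainComplex X.Modules ℤ} (hK : ∀ i, Mono (mulHom a (K.X i)))
    (hc : ∀ i, IsCoherent (K.homology i)) (i : ℤ) :
    IsCoherent ((((Scheme.Modules.pullback f).mapHomologicalComplex (ComplexShape.up ℤ)).obj
      K).homology i) := by
  have := hf.isClosedImmersion
  have hK' := hf.shortExact_unitCpx K hK
  have h1 := IsCoherent.of_exact _ _ _ _ _ _ _ (hK'.homology_exact₂ i)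
    (hK'.homology_exact₃ i (i + 1) rfl) (hK'.homology_exact₁ i (i + 1) rfl)
    (hc i) (hc i) (hc (i + 1)) (hc (i + 1))
  -- Coherence is so far known only for the pushforward; pulling back and applying the counit
  -- recovers the sheaf on `Z`.
  have h2 := (h1.of_iso (homologyMapIso (Scheme.Modules.pushforward f) _ i)).pullback f
  have := hf.isIso_counit ((((Scheme.Modules.pullback f).mapHomologicalComplex
    (ComplexShape.up ℤ)).obj K).homology i)
  exact h2.of_iso (asIso ((Scheme.Modules.pullbackPushforwardAdjunction f).counit.app _))

end Derived

/-! ### Passage between the heart and the conditions on complexes. -/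

section Heart

variable {X Z : Scheme.{u}}

lemma MemHeart.heartLike {K : CochainComplex X.Modules ℤ} {E : DMod X}
    (e : DerivedCategory.Q.obj K ≅ E) (h : MemHeart E) :
    HeartLike (supp (H 0 E)) (CohLE 1) K where
  isZero i h0 h1 := (h.2.2.2 i h0 h1).of_iso (homologyIsoOfRepresents e i).symm
  supp_le := (supp_of_iso (homologyIsoOfRepresents e 0)).symm.subset
  hom_eq_zero F hF g := by
    rw [← cancel_mono (homologyIsoOfRepresents e (-1)).inv, zero_comp]
    exact h.2.2.1.2 F hF _

lemma HeartLike.memHeart {K : CochainComplex X.Modules ℤ} {E : DMod X}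
    (e : DerivedCategory.Q.obj K ≅ E) (hE : MemD E) {S : Set X} {P : X.Modules → Prop}
    (h : HeartLike S P K) (hS : topologicalKrullDim S ≤ 1) (hP : ∀ F, CohLE 1 F → P F) :
    MemHeart E := by
  have hz : ∀ i : ℤ, i ≠ 0 → i ≠ -1 → IsZero (H i E) := fun i h0 h1 =>
    (h.isZero i h0 h1).of_iso (homologyIsoOfRepresents e i)
  refine ⟨⟨hE, -1, 0, fun i hi => hz i (by lia) (by lia)⟩, ⟨hE 0, ?_⟩,
    ⟨hE (-1), fun F hF g => ?_⟩, hz⟩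
  · refine le_trans (krullDim_mono ?_) hS
    exact (supp_of_iso (homologyIsoOfRepresents e 0)).subset.trans h.supp_le
  · rw [← cancel_mono (homologyIsoOfRepresents e (-1)).hom, zero_comp]
    exact h.hom_eq_zero F (hP F hF) _

/-- An object lies in the heart if its restriction to a subscheme cut out by a nilpotent function
does, provided that it is represented by a complex whose terms behave like flat modules. -/
lemma memHeart_of_pullback {f : Z ⟶ X} {a : Γ(X, ⊤)} (hf : IsCutOutBy f a) {m : ℕ} (hm : 1 ≤ m)
    (ha : a ^ m = 0) (K : CochainComplex X.Modules ℤ)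
    (hex : ∀ (n : ℤ) (i j : ℕ), 0 < i → 0 < j → ∀ hij : i + j = m,
      (ShortComplex.mk (mulHom (a ^ i) (K.X n)) (mulHom (a ^ j) (K.X n)) (by
        rw [← mulHom_mul, ← pow_add, hij, ha, mulHom_zero])).Exact)
    {E : DMod X} (e : DerivedCategory.Q.obj K ≅ E) (hE : MemD E) {S : Set Z}
    (hS : topologicalKrullDim S ≤ 1)
    (h : HeartLike S (CohLE 1)
      (((Scheme.Modules.pullback f).mapHomologicalComplex (ComplexShape.up ℤ)).obj K)) :
    MemHeart E := by
  have := hf.isClosedImmersion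
  exact (HeartLike.of_pullback hf hm ha K hex h).memHeart e hE
    ((krullDim_image_le f.isEmbedding S).trans hS) fun F hF => hF.pullback hf

end Heart

/-! ### Multiplication maps on flat modules and on their restrictions. -/

section Flatness

variable {X : Scheme.{u}} {A : CommRingCat.{u}} (g : X ⟶ Spec A) [Flat g] {M : X.Modules}

lemma exact_mulHom_of_isFlat (hM : IsFlat M) (b c : A)
    (h : ∀ x : A, c * x = 0 → ∃ y, x = b * y) (hbc : c * b = 0)
    (w : mulHom (structureSection g b) M ≫ mulHom (structureSection g c) M = 0) :
    (ShortComplex.mk _ _ w).Exact := by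
  rw [exact_iff_stalk]
  intro x
  rw [ShortComplex.ab_exact_iff]
  intro (m : (stalkAb x).obj M) hm
  have : Module.Flat (X.presheaf.stalk x) ((stalkAb x).obj M) := hM x
  have hm : (stalkAb x).map (mulHom (structureSection g c) M) m = 0 := hm
  rw [mulHom_stalk] at hm
  obtain ⟨m', hm'⟩ := exists_smul_eq_of_flat _ (flat_germ_structureSection g x) b c h hbc m hm
  refine ⟨m', ?_⟩
  rw [hm']
  exact mulHom_stalk _ _ _ _

lemma mono_mulHom_of_isFlat (hM : IsFlat M) (c : A) (h : ∀ x : A, c * x = 0 → x = 0) :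
    Mono (mulHom (structureSection g c) M) := by
  rw [mono_iff_stalk]
  intro x
  rw [AddCommGrpCat.mono_iff_injective]
  refine (injective_iff_map_eq_zero _).2 fun (m : (stalkAb x).obj M) hm => ?_
  have : Module.Flat (X.presheaf.stalk x) ((stalkAb x).obj M) := hM x
  rw [mulHom_stalk] at hm
  -- Exactness of the pair `(0, c)` is injectivity of `c`.
  obtain ⟨m', hm'⟩ := exists_smul_eq_of_flat _ (flat_germ_structureSection g x) 0 c
    (fun x hx => ⟨0, by rw [h x hx, mul_zero]⟩) (mul_zero _) m hm
  rw [hm', map_zero, zero_smul]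

/-- The exactness of multiplication by powers on a quotient by a regular element. -/
lemma IsCutOutBy.exact_mulHom_pullback {X Z : Scheme.{u}} {f : Z ⟶ X} {a : Γ(X, ⊤)} {i j : ℕ}
    (hf : IsCutOutBy f (a ^ (i + j))) (M : X.Modules) (hM : Mono (mulHom (a ^ j) M))
    (w : mulHom (f.appTop a ^ i) ((Scheme.Modules.pullback f).obj M) ≫
      mulHom (f.appTop a ^ j) ((Scheme.Modules.pullback f).obj M) = 0) :
    (ShortComplex.mk _ _ w).Exact := by
  have := hf.isClosedImmersion
  rw [← ShortComplex.exact_map_iff_of_faithful _ (Scheme.Modules.pushforward f)]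
  let N := (Scheme.Modules.pushforward f).obj ((Scheme.Modules.pullback f).obj M)
  have hw : mulHom (a ^ i) N ≫ mulHom (a ^ j) N = 0 := by
    rw [← mulHom_mul, ← pow_add]
    exact hf.mulHom_pushforward _
  have key : (ShortComplex.mk _ _ hw).Exact := by
    let η : M ⟶ N := (Scheme.Modules.pullbackPushforwardAdjunction f).unit.app M
    obtain ⟨h1, h2⟩ := hf.exact_unit M (hf.mulHom_unit M)
    have h2 : Epi η := h2
    rw [ShortComplex.exact_iff_exact_up_to_refinements]
    intro T t ht
    dsimp only at t ht
    obtain ⟨T₁, π₁, _, t₁, ht₁⟩ := surjective_up_to_refinements_of_epi η t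
    have h3 : (t₁ ≫ mulHom (a ^ j) M) ≫ η = 0 := by
      rw [Category.assoc, mulHom_naturality, ← Category.assoc, ← ht₁, Category.assoc, ht, comp_zero]
    obtain ⟨T₂, π₂, _, u, hu⟩ := h1.exact_up_to_refinements _ h3
    dsimp only at u hu
    -- From `a^j t₁ = a^(i + j) u` the injective factor `a^j` is cancelled, leaving `t₁ = a^i u`.
    rw [pow_add, mulHom_mul, ← Category.assoc, ← Category.assoc, cancel_mono] at hu
    refine ⟨T₂, π₂ ≫ π₁, inferInstance, u ≫ η, ?_⟩
    dsimp only
    rw [Category.assoc, ht₁, ← Category.assoc, hu, Category.assoc, mulHom_naturality,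
      Category.assoc]
  have e1 : ∀ n : ℕ, (Scheme.Modules.pushforward f).map
      (mulHom (f.appTop a ^ n) ((Scheme.Modules.pullback f).obj M)) = mulHom (a ^ n) N :=
    fun n => by
    rw [← pushforward_map_mulHom, map_pow]
  have key' : ∀ (p q : N ⟶ N) (_ : p = mulHom (a ^ i) N) (_ : q = mulHom (a ^ j) N)
    (w' : p ≫ q = 0),
      (ShortComplex.mk p q w').Exact := by
    rintro _ _ rfl rfl _
    exact key
  exact key' _ _ (e1 i) (e1 j) _

end Flatness

/-! ### The thickenings `X_m` and the two halves of the proposition. -/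

section Thickenings

variable {k : Type u} [Field k] {X : Scheme.{u}} (s : X ⟶ Spec (.of k))
  {R : Type u} [CommRing R] [Algebra k R] (π : R)

/-- The uniformiser, as a function on `X_m`. -/
def uniformiser (m : ℕ) : Γ(thickening s π m, ⊤) :=
  structureSection (toSpec s (R ⧸ Ideal.span {π ^ m})) (Ideal.Quotient.mk _ π)

lemma uniformiser_pow (m : ℕ) : uniformiser s π m ^ m = 0 := by
  rw [uniformiser, ← map_pow, ← map_pow,
    Ideal.Quotient.eq_zero_iff_mem.2 (Ideal.mem_span_singleton_self _), map_zero]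

lemma isCutOutBy_iota (m : ℕ) :
    IsCutOutBy (iota s π m) (structureSection (toSpec s R) π ^ m) := by
  rw [← map_pow]
  refine isCutOutBy_baseChangeMap s _ Ideal.Quotient.mk_surjective (π ^ m) ?_
  exact Ideal.mk_ker

lemma isCutOutBy_iotaTrans {m : ℕ} (hm : 1 ≤ m) :
    IsCutOutBy (iotaTrans s π hm) (uniformiser s π m) := by
  refine isCutOutBy_baseChangeMap s _ 
    (Ideal.Quotient.factor_surjective (Ideal.span_singleton_le_span_singleton.mpr
      (pow_dvd_pow π hm))) _ ?_
  ext x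
  obtain ⟨x, rfl⟩ := Ideal.Quotient.mk_surjective x
  rw [Ideal.mem_span_singleton', RingHom.mem_ker]
  have h1 : (Ideal.Quotient.mk (Ideal.span {π ^ 1}) x = 0) ↔ ∃ c, c * π = x := by
    rw [Ideal.Quotient.eq_zero_iff_mem, Ideal.mem_span_singleton', pow_one]
  refine h1.trans ⟨?_, ?_⟩
  · rintro ⟨c, rfl⟩
    exact ⟨Ideal.Quotient.mk _ c, (map_mul _ _ _).symm⟩
  · rintro ⟨c, hc⟩
    obtain ⟨c, rfl⟩ := Ideal.Quotient.mk_surjective c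
    rw [← map_mul, Ideal.Quotient.mk_eq_mk_iff_sub_mem, Ideal.mem_span_singleton'] at hc
    obtain ⟨d, hd⟩ := hc
    refine ⟨c - d * π ^ (m - 1), ?_⟩
    have : π ^ m = π ^ (m - 1) * π := by
      rw [← pow_succ, Nat.sub_add_cancel hm]
    rw [this] at hd
    linear_combination -hd

lemma iota_appTop (m : ℕ) :
    (iota s π m).appTop (structureSection (toSpec s R) π) = uniformiser s π m := by
  rw [← ConcreteCategory.comp_apply, ← structureSection_comp]
  have : iota s π m ≫ toSpec s R = _ := baseChangeMap_toSpec s _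
  rw [this, structureSection_specMap]
  rfl

lemma iotaTrans_iota {m : ℕ} (hm : 1 ≤ m) : iotaTrans s π hm ≫ iota s π m = iota s π 1 := by
  refine (baseChangeMap_comp s _ _).trans ?_
  rfl

variable [IsDomain R] {π} (hπ : π ≠ 0)

include hπ

variable (π) in
-- Cancel `π^j` in the domain `R` from `π^j x = c π^(i + j)`.
lemma quotient_mk_pow_exact {i j m : ℕ} (hij : i + j = m) (x : R ⧸ Ideal.span {π ^ m})
    (hx : Ideal.Quotient.mk (Ideal.span {π ^ m}) π ^ j * x = 0) :
    ∃ y, x = Ideal.Quotient.mk (Ideal.span {π ^ m}) π ^ i * y := by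
  obtain ⟨x, rfl⟩ := Ideal.Quotient.mk_surjective x
  rw [← map_pow, ← map_mul, Ideal.Quotient.eq_zero_iff_mem, Ideal.mem_span_singleton'] at hx
  obtain ⟨c, hc⟩ := hx
  refine ⟨Ideal.Quotient.mk _ c, ?_⟩
  rw [← map_pow, ← map_mul]
  congr 1
  apply mul_left_cancel₀ (pow_ne_zero j hπ)
  rw [← hc, ← hij]
  ring

variable (π) in
lemma memHeart_of_iotaTrans [Flat s] {m : ℕ} (hm : 1 ≤ m) (E : DMod (thickening s π m))
    (hE : MemD E) (G : DMod (thickening s π 1)) (hG : IsDerivedPullback (iotaTrans s π hm) E G)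
    (hGh : MemHeart G) : MemHeart E := by
  obtain ⟨P, hP, ⟨e⟩⟩ := hG
  obtain ⟨e'⟩ := hP.represents
  refine memHeart_of_pullback (isCutOutBy_iotaTrans s π hm) hm (uniformiser_pow s π m) P
    (fun n i j _ _ hij => ?_) e' hE hGh.2.1.2 (hGh.heartLike e)
  have h := exact_mulHom_of_isFlat (toSpec s (R ⧸ Ideal.span {π ^ m})) (hP.flat n)
    (Ideal.Quotient.mk _ π ^ i) (Ideal.Quotient.mk _ π ^ j) (quotient_mk_pow_exact π hπ hij)
    (by
      rw [← pow_add, add_comm, hij, ← map_pow]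
      exact Ideal.Quotient.eq_zero_iff_mem.2 (Ideal.mem_span_singleton_self _))
  simp only [map_pow] at h
  exact h (by
    rw [← mulHom_mul, ← pow_add, hij]
    exact (congrArg (fun b => mulHom b (P.X n)) (uniformiser_pow s π m)).trans (mulHom_zero _))

variable (π) in
-- The filtration argument is applied to `K`, the termwise pullback of the resolution that defines
-- `G`. Exactness of the powers on its terms comes from regularity of `π` on the flat terms over
-- `X_R`.
lemma memHeart_of_iota [Flat s] [LocallyOfFiniteType s] [IsNoetherianRing R] {m : ℕ} (hm : 1 ≤ m)
    (I : DMod (baseChange s R)) (hI : IsFlatFamily s π I) (G : DMod (thickening s π m))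
    (hG : IsDerivedPullback (iota s π m) I G) : MemHeart G := by
  obtain ⟨⟨hIc, -⟩, G₁, ⟨P₁, hP₁, ⟨e₁⟩⟩, hG₁⟩ := hI
  obtain ⟨P, hP, ⟨e⟩⟩ := hG
  obtain ⟨i₁⟩ := hP₁.represents
  obtain ⟨i₂⟩ := hP.represents
  have := isLocallyNoetherian_baseChange s R
  let a := structureSection (toSpec s R) π
  have hmono : ∀ (M : (baseChange s R).Modules) (_ : IsFlat M) (n : ℕ),
      Mono (mulHom (a ^ n) M) := by
    intro M hM n
    have := mono_mulHom_of_isFlat (toSpec s R) hM (π ^ n)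
      (fun x hx => (mul_eq_zero.1 hx).resolve_left (pow_ne_zero n hπ))
    rwa [map_pow] at this
  have hcut := isCutOutBy_iota s π m
  have hcut₁ := isCutOutBy_iota s π 1
  let K := ((Scheme.Modules.pullback (iota s π m)).mapHomologicalComplex (ComplexShape.up ℤ)).obj P
  have hGc : MemD G := fun i =>
    (hcut.isCoherent_homology_pullback (fun n => hmono _ (hP.flat n) m)
      (fun n => (hIc n).of_iso (homologyIsoOfRepresents i₂ n)) i).of_iso
        (homologyIsoOfRepresents e i).symm
  -- Restricting `P` to `X_m` and then to `X_1` is restricting it to `X_1` directly.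
  have c : ((Scheme.Modules.pullback (iotaTrans s π hm)).mapHomologicalComplex
        (ComplexShape.up ℤ)).obj K ≅ ((Scheme.Modules.pullback (iota s π 1)).mapHomologicalComplex
        (ComplexShape.up ℤ)).obj P :=
    (NatIso.mapHomologicalComplex (Scheme.Modules.pullbackComp (iotaTrans s π hm) (iota s π m) ≪≫
      Scheme.Modules.pullbackCongr (iotaTrans_iota s π hm)) (ComplexShape.up ℤ)).app P
  -- The family hypothesis concerns the resolution `P₁`, while `K` comes from `P`; their
  -- restrictions to `X_1` have the same cohomology.
  have hh : ∀ i, Nonempty (_ ≅ _) := fun i => hcut₁.homology_pullback_iso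
    (fun n => hmono _ (hP₁.flat n) 1) (fun n => hmono _ (hP.flat n) 1) (i₁ ≪≫ i₂.symm) i
  refine memHeart_of_pullback (isCutOutBy_iotaTrans s π hm) hm (uniformiser_pow s π m) K
    (fun n i j _ _ hij => ?_) e hGc hG₁.2.1.2 
    (((hG₁.heartLike e₁).of_homologyIso fun i => (hh i).some).of_iso c.symm)
  subst hij
  have := (isCutOutBy_iota s π (i + j)).exact_mulHom_pullback (P.X n) (hmono _ (hP.flat n) j)
  rw [iota_appTop] at this
  exact this _

end Thickenings

end

end PervHeart

theorem proposition5p9 {k : Type u} [Field k] [IsAlgClosed k] [CharZero k]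
    {X : Scheme.{u}} (s : X ⟶ Spec (.of k))
    (hX : IsSmoothProjectiveThreefold s)
    {R : Type u} [CommRing R] [IsDomain R] [IsDiscreteValuationRing R] [Algebra k R]
    (π : R) (hπ : Irreducible π) (m : ℕ) (hm : 1 ≤ m) :
    (∀ E : DMod (thickening s π m),
      MemD E →
      (∀ i : ℤ, 0 < i → IsZero (H i E)) →
      ∀ G : DMod (thickening s π 1),
        IsDerivedPullback (iotaTrans s π hm) E G →
        MemHeart G → MemHeart E) ∧
    (∀ I : DMod (baseChange s R),
      IsFlatFamily s π I →
      ∀ G : DMod (thickening s π m),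
        IsDerivedPullback (iota s π m) I G → MemHeart G) := by
  -- Smoothness provides the flatness and the local finiteness of type of `s` on which both halves
  -- rely.
  have hsm : Smooth s := hX.smooth
  refine ⟨fun E hE _ G hG hGh => memHeart_of_iotaTrans s π hπ.ne_zero hm E hE G hG hGh,
    fun I hI G hG => memHeart_of_iota s π hπ.ne_zero hm I hI G hG⟩
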